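/- **Notation.** Fix $h\in\mathbb C$ such that $q=e^{h}$ is not a root of unity, and put $q^{x}=e^{hx}$, $[x]=\frac{q^{x}-q^{-x}}{q-q^{-1}}$ for $x\in\mathbb C$, $[n]!=\prod_{j=1}^{n}[j]$, and $(-1)^x=e^{i\pi x}$. A weight $\lambda\in\mathbb C$ is *generic* if $[2\lambda+j]\neq 0$ for all $j\in\mathbb Z$. $U_q(\mathfrak{sl}_2)$ is the algebra generated by $E,F,K^{\pm1}$ (where $K=q^{H/2}$) with relations $KE=qEK$, $KF=q^{-1}FK$, $EF-FE=\frac{K^{2}-K^{-2}}{q-q^{-1}}$ and coproduct $\Delta(E)=E\otimes K+K^{-1}\otimes E$, $\Delta(F)=F\otimes K+K^{-1}\otimes F$, $\Delta(K)=K\otimes K$. The Verma module $M_\lambda$ has basis $e^\lambda_a$, $a=\lambda,\lambda-1,\lambda-2,\dots$, with $Ke^\lambda_a=q^{a}e^\lambda_a$, $Fe^\lambda_a=e^\lambda_{a-1}$, $Ee^\lambda_a=[\lambda-a][\lambda+a+1]e^\lambda_{a+1}$. For $\lambda_{12}=\lambda_1+\lambda_2-n$, $n\in\mathbb Z_{\ge0}$,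 let $\psi:M_{\lambda_{12}}\to M_{\lambda_1}\otimes M_{\lambda_2}$ be the embedding of $U_q(\mathfrak{sl}_2)$-modules that sends $e^{\lambda_{12}}_{\lambda_{12}}$ to the highest weight vector $$\vartheta(\lambda_1,\lambda_2,\lambda_{12})\sum_{i=0}^{n}(-1)^{i}\,\frac{q^{(\lambda_1-i)(\lambda_{12}+1)+\frac12(\lambda_2(\lambda_2+1)-\lambda_1(\lambda_1+1)-\lambda_{12}(\lambda_{12}+1))}}{\alpha_{\lambda_1,i}\,\alpha_{\lambda_2,n-i}}\;e^{\lambda_1}_{\lambda_1-i}\otimes e^{\lambda_2}_{\lambda_2-n+i},$$ where $\alpha_{\lambda,m}=[m]!\prod_{j=0}^{m-1}[2\lambda-j]$ and $\vartheta(\lambda_1,\lambda_2,\lambda_{12})=\Big([n]!\prod_{j=0}^{n-1}\frac{[2\lambda_1-j][2\lambda_2-j]}{[2\lambda_{12}+2+j]}\Big)^{1/2}$ (principal square root). For weights with $\lambda_1+\lambda_2+\lambda_3-\lambda=N$, $\lambda_1+\lambda_2-\lambda_{12}$ and $\lambda_2+\lambda_3-\lambda_{23}$ in $\mathbb Z_{\ge0}$,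 the last two at most $N$, let $e^{\lambda_{12},\lambda}_a$ and $e^{\lambda_{23},\lambda}_a$ be the images of $e^\lambda_a$ in $M_{\lambda_1}\otimes M_{\lambda_2}\otimes M_{\lambda_3}$ under $M_\lambda\to M_{\lambda_{12}}\otimes M_{\lambda_3}\to (M_{\lambda_1}\otimes M_{\lambda_2})\otimes M_{\lambda_3}$ and $M_\lambda\to M_{\lambda_1}\otimes M_{\lambda_{23}}\to M_{\lambda_1}\otimes (M_{\lambda_2}\otimes M_{\lambda_3})$. The $q6j$-symbols are the coefficients in $$e^{\lambda_{12},\lambda}_a=\sum_{\lambda_{23}}\begin{Bmatrix}\lambda_1&\lambda_2&\lambda_{12}\\ \lambda_3&\lambda&\lambda_{23}\end{Bmatrix}_q e^{\lambda_{23},\lambda}_a\qquad\text{for all } a=\lambda,\lambda-1,\lambda-2,\dots,$$ where $\lambda_{23}$ runs over $\lambda_2+\lambda_3-j$, $j=0,\dots,N$. **Theorem (Racah identity).** Let $\lambda_1,\lambda_2,\lambda_3,\lambda_{13},\lambda_{23},\lambda_{123}\in\mathbb C$ be such that $N=\lambda_1+\lambda_2+\lambda_3-\lambda_{123}$, $\lambda_1+\lambda_3-\lambda_{13}$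 and $\lambda_2+\lambda_3-\lambda_{23}$ are non-negative integers, the last two at most $N$, and such that $\lambda_1,\lambda_2,\lambda_3,\lambda_1+\lambda_2,\lambda_{13},\lambda_{23},\lambda_{123}$ are generic. Then the $q6j$-symbols of $\lambda_1,\lambda_2,\lambda_3,\lambda_{123}$ are well defined (for each of the $N+1$ values of $\lambda_{12}$ the expansion above, with $\lambda=\lambda_{123}$, exists and is unique), and $$\sum_{\alpha}(-1)^{\alpha}q^{-\alpha(\alpha+1)}\begin{Bmatrix}\lambda_1&\lambda_2&\alpha\\ \lambda_3&\lambda_{123}&\lambda_{23}\end{Bmatrix}_q\begin{Bmatrix}\lambda_3&\lambda_1&\lambda_{13}\\ \lambda_2&\lambda_{123}&\alpha\end{Bmatrix}_q$$ $$=(-1)^{\lambda_1+\lambda_2+\lambda_3+\lambda_{123}-\lambda_{13}-\lambda_{23}}\,q^{\lambda_{13}(\lambda_{13}+1)+\lambda_{23}(\lambda_{23}+1)-\lambda_1(\lambda_1+1)-\lambda_2(\lambda_2+1)-\lambda_3(\lambda_3+1)-\lambda_{123}(\lambda_{123}+1)}\begin{Bmatrix}\lambda_1&\lambda_3&\lambda_{13}\\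 \lambda_2&\lambda_{123}&\lambda_{23}\end{Bmatrix}_q,$$ where the sum is over $\alpha=\lambda_1+\lambda_2-j$, $j=0,1,\dots,N$. -/

import Mathlib

open scoped TensorProduct

noncomputable section

namespace QSixJ

/-! ### Quantum numbers -/

/-- The complex power `q ^ x = exp (h x)` of `q = exp h`, for a fixed logarithm `h` of `q`. -/
def qpow (h x : ℂ) : ℂ := Complex.exp (h * x)

/-- The quantum number `[x] = (q ^ x - q ^ (-x)) / (q - q ^ (-1))`. -/
def qnum (h x : ℂ) : ℂ := (qpow h x - qpow h (-x)) / (qpow h 1 - qpow h (-1))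

/-- The quantum factorial `[n]! = [1] [2] ⋯ [n]`. -/
def qfact (h : ℂ) (n : ℕ) : ℂ := ∏ j ∈ Finset.range n, qnum h (j + 1)

/-- `q = exp h` is not a root of unity. -/
def NotRootOfUnity (h : ℂ) : Prop := ∀ n : ℕ, 0 < n → Complex.exp h ^ n ≠ 1

/-- A weight `l` is generic if none of the quantum numbers `[2 l + j]`, `j ∈ ℤ`, vanishes. -/
def Generic (h l : ℂ) : Prop := ∀ j : ℤ, qnum h (2 * l + j) ≠ 0

/-! ### The Hopf algebra `U_q(sl₂)` -/

/-- The generators of `U_q(sl₂)`; `K` stands for `q ^ (H / 2)`. -/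
inductive Gen
  | E | F | K | Kinv

/-- The free algebra generator. -/
abbrev gen (x : Gen) : FreeAlgebra ℂ Gen := FreeAlgebra.ι ℂ x

/-- The defining relations of `U_q(sl₂)`. -/
inductive Rel (h : ℂ) : FreeAlgebra ℂ Gen → FreeAlgebra ℂ Gen → Prop
  | K_Kinv : Rel h (gen .K * gen .Kinv) 1
  | Kinv_K : Rel h (gen .Kinv * gen .K) 1
  | K_E : Rel h (gen .K * gen .E) (qpow h 1 • (gen .E * gen .K))
  | K_F : Rel h (gen .K * gen .F) (qpow h (-1) • (gen .F * gen .K))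
  | E_F : Rel h (gen .E * gen .F - gen .F * gen .E)
      ((qpow h 1 - qpow h (-1))⁻¹ • (gen .K * gen .K - gen .Kinv * gen .Kinv))

/-- The quantum group `U_q(sl₂)`, `q = exp h`. -/
abbrev Uq (h : ℂ) : Type := RingQuot (Rel h)

/-- The image of a generator in `U_q(sl₂)`. -/
def Uq.of (h : ℂ) (x : Gen) : Uq h := RingQuot.mkAlgHom ℂ (Rel h) (gen x)

theorem qpow_add (h x y : ℂ) : qpow h (x + y) = qpow h x * qpow h y := by
  simp [qpow, mul_add, Complex.exp_add]

theorem qpow_zero (h : ℂ) : qpow h 0 = 1 := by simp [qpow]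

theorem qpow_mul_neg (h x : ℂ) : qpow h x * qpow h (-x) = 1 := by
  rw [← qpow_add]; simp [qpow]

theorem Uq.K_Kinv (h : ℂ) : Uq.of h .K * Uq.of h .Kinv = 1 := by
  simpa [Uq.of] using RingQuot.mkAlgHom_rel ℂ (Rel.K_Kinv (h := h))

theorem Uq.Kinv_K (h : ℂ) : Uq.of h .Kinv * Uq.of h .K = 1 := by
  simpa [Uq.of] using RingQuot.mkAlgHom_rel ℂ (Rel.Kinv_K (h := h))

theorem Uq.K_E (h : ℂ) :
    Uq.of h .K * Uq.of h .E = qpow h 1 • (Uq.of h .E * Uq.of h .K) := by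
  simpa [Uq.of] using RingQuot.mkAlgHom_rel ℂ (Rel.K_E (h := h))

theorem Uq.K_F (h : ℂ) :
    Uq.of h .K * Uq.of h .F = qpow h (-1) • (Uq.of h .F * Uq.of h .K) := by
  simpa [Uq.of] using RingQuot.mkAlgHom_rel ℂ (Rel.K_F (h := h))

theorem Uq.E_F (h : ℂ) :
    Uq.of h .E * Uq.of h .F - Uq.of h .F * Uq.of h .E =
      (qpow h 1 - qpow h (-1))⁻¹ •
        (Uq.of h .K * Uq.of h .K - Uq.of h .Kinv * Uq.of h .Kinv) := by
  simpa [Uq.of] using RingQuot.mkAlgHom_rel ℂ (Rel.E_F (h := h))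

/-- An element commuting with `K` up to a factor commutes with `K⁻¹` up to the inverse factor. -/
theorem Uq.mul_Kinv_of {h c : ℂ} {x : Uq h}
    (hx : Uq.of h .K * x = c • (x * Uq.of h .K)) :
    x * Uq.of h .Kinv = c • (Uq.of h .Kinv * x) := by
  have h1 : Uq.of h .Kinv * (Uq.of h .K * x) * Uq.of h .Kinv = x * Uq.of h .Kinv := by
    rw [← mul_assoc, Uq.Kinv_K, one_mul]
  rw [← h1, hx, mul_smul_comm, smul_mul_assoc, mul_assoc, mul_assoc, Uq.K_Kinv, mul_one]

/-- The values of the coproduct on the generators: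
`Δ(E) = E ⊗ K + K⁻¹ ⊗ E`, `Δ(F) = F ⊗ K + K⁻¹ ⊗ F`, `Δ(K) = K ⊗ K`. -/
def comulGen (h : ℂ) : Gen → Uq h ⊗[ℂ] Uq h
  | .E => Uq.of h .E ⊗ₜ Uq.of h .K + Uq.of h .Kinv ⊗ₜ Uq.of h .E
  | .F => Uq.of h .F ⊗ₜ Uq.of h .K + Uq.of h .Kinv ⊗ₜ Uq.of h .F
  | .K => Uq.of h .K ⊗ₜ Uq.of h .K
  | .Kinv => Uq.of h .Kinv ⊗ₜ Uq.of h .Kinv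

theorem comulGen_rel (h : ℂ) ⦃x y : FreeAlgebra ℂ Gen⦄ (r : Rel h x y) :
    FreeAlgebra.lift ℂ (comulGen h) x = FreeAlgebra.lift ℂ (comulGen h) y := by
  have hE := Uq.mul_Kinv_of (Uq.K_E h)
  have hF := Uq.mul_Kinv_of (Uq.K_F h)
  have hq := qpow_mul_neg h 1
  cases r
  · simp [comulGen, Uq.K_Kinv, Algebra.TensorProduct.one_def]
  · simp [comulGen, Uq.Kinv_K, Algebra.TensorProduct.one_def]
  · simp [comulGen, mul_add, add_mul, Uq.K_E, Uq.K_Kinv, Uq.Kinv_K, TensorProduct.smul_tmul',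
      TensorProduct.tmul_smul]
  · simp [comulGen, mul_add, add_mul, Uq.K_F, Uq.K_Kinv, Uq.Kinv_K, TensorProduct.smul_tmul',
      TensorProduct.tmul_smul]
  · have h1 : (Uq.of h .E * Uq.of h .Kinv) ⊗ₜ[ℂ] (Uq.of h .K * Uq.of h .F) =
        (Uq.of h .Kinv * Uq.of h .E) ⊗ₜ[ℂ] (Uq.of h .F * Uq.of h .K) := by
      rw [hE, Uq.K_F, TensorProduct.smul_tmul_smul, hq, one_smul]
    have h2 : (Uq.of h .F * Uq.of h .Kinv) ⊗ₜ[ℂ] (Uq.of h .K * Uq.of h .E) =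
        (Uq.of h .Kinv * Uq.of h .F) ⊗ₜ[ℂ] (Uq.of h .E * Uq.of h .K) := by
      rw [hF, Uq.K_E, TensorProduct.smul_tmul_smul, mul_comm, hq, one_smul]
    have h3 := congrArg (fun z => z ⊗ₜ[ℂ] (Uq.of h .K * Uq.of h .K)) (Uq.E_F h)
    have h4 := congrArg (fun z => (Uq.of h .Kinv * Uq.of h .Kinv) ⊗ₜ[ℂ] z) (Uq.E_F h)
    simp only [TensorProduct.sub_tmul, TensorProduct.tmul_sub, TensorProduct.tmul_smul,
      ← TensorProduct.smul_tmul'] at h3 h4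
    simp only [map_sub, map_mul, map_smul, FreeAlgebra.lift_ι_apply, comulGen, mul_add, add_mul,
      Algebra.TensorProduct.tmul_mul_tmul, h1, h2]
    have h5 := congrArg₂ (· + ·) h3 h4
    beta_reduce at h5
    have h6 : ∀ a b c d a' d' t : Uq h ⊗[ℂ] Uq h, a - a' + (d - d') = t →
        a + b + (c + d) - (a' + c + (b + d')) = t := by
      intro a b c d a' d' t hh
      rw [← hh]; abel
    rw [← smul_add, sub_add_sub_cancel] at h5
    exact h6 _ _ _ _ _ _ _ h5

/-- The coproduct of `U_q(sl₂)`. -/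
def comul (h : ℂ) : Uq h →ₐ[ℂ] Uq h ⊗[ℂ] Uq h :=
  RingQuot.liftAlgHom ℂ ⟨FreeAlgebra.lift ℂ (comulGen h), comulGen_rel h⟩

/-! ### Verma modules and their tensor products -/

/-- The space underlying all Verma modules. In `M_l` the basis vector with index `m` is the
weight vector `e^l_a`, `a = l - m`. -/
abbrev V : Type := ℕ →₀ ℂ

/-- The weight vector `e^l_{l - m}`. -/
abbrev e (m : ℕ) : V := Finsupp.single m 1

/-- The action of the generators on `M_l`: `E e_a = [l - a] [l + a + 1] e_{a + 1}`,
`F e_a = e_{a - 1}`, `K e_a = q ^ a e_a`. -/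
def vermaGen (h l : ℂ) : Gen → Module.End ℂ V
  | .E => Finsupp.linearCombination ℂ fun m : ℕ =>
      (qnum h m * qnum h (2 * l - m + 1)) • e (m - 1)
  | .F => Finsupp.linearCombination ℂ fun m : ℕ => e (m + 1)
  | .K => Finsupp.linearCombination ℂ fun m : ℕ => qpow h (l - m) • e m
  | .Kinv => Finsupp.linearCombination ℂ fun m : ℕ => qpow h (-(l - m)) • e m

theorem vermaGen_E (h l : ℂ) (m : ℕ) : vermaGen h l .E (e m) =
    (qnum h m * qnum h (2 * l - m + 1)) • e (m - 1) := by
  rw [vermaGen, Finsupp.linearCombination_single, one_smul]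

theorem vermaGen_F (h l : ℂ) (m : ℕ) : vermaGen h l .F (e m) = e (m + 1) := by
  rw [vermaGen, Finsupp.linearCombination_single, one_smul]

theorem vermaGen_K (h l : ℂ) (m : ℕ) : vermaGen h l .K (e m) = qpow h (l - m) • e m := by
  rw [vermaGen, Finsupp.linearCombination_single, one_smul]

theorem vermaGen_Kinv (h l : ℂ) (m : ℕ) :
    vermaGen h l .Kinv (e m) = qpow h (-(l - m)) • e m := by
  rw [vermaGen, Finsupp.linearCombination_single, one_smul]

theorem qnum_comm (h l : ℂ) (m : ℂ) :
    qnum h (m + 1) * qnum h (2 * l - m) - qnum h m * qnum h (2 * l - m + 1) =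
      (qpow h 1 - qpow h (-1))⁻¹ *
        (qpow h (l - m) * qpow h (l - m) - qpow h (-(l - m)) * qpow h (-(l - m))) := by
  simp only [qnum]
  by_cases h0 : qpow h 1 - qpow h (-1) = 0
  · simp [h0]
  · field_simp
    simp only [sub_mul, mul_sub, pow_two, ← qpow_add]
    ring_nf

theorem vermaGen_rel (h l : ℂ) ⦃x y : FreeAlgebra ℂ Gen⦄ (r : Rel h x y) :
    FreeAlgebra.lift ℂ (vermaGen h l) x = FreeAlgebra.lift ℂ (vermaGen h l) y := by
  cases r <;> refine Finsupp.lhom_ext' fun m => LinearMap.ext_ring ?_ <;>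
    simp only [map_sub, map_mul, map_smul, map_one, FreeAlgebra.lift_ι_apply, gen,
      LinearMap.comp_apply, Finsupp.lsingle_apply, Module.End.mul_apply, Module.End.one_apply,
      LinearMap.sub_apply, LinearMap.smul_apply, vermaGen_E, vermaGen_F, vermaGen_K,
      vermaGen_Kinv, smul_smul]
  · rw [mul_comm, qpow_mul_neg, one_smul]
  · rw [qpow_mul_neg, one_smul]
  · rcases m with _ | m
    · simp [qnum]
    · have h1 : qpow h (l - m) = qpow h 1 * qpow h (l - (m + 1 : ℕ)) := by
        rw [← qpow_add]; congr 1; push_cast; ring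
      rw [Nat.add_sub_cancel, h1]; congr 1; ring
  · have h1 : qpow h (l - (m + 1 : ℕ)) = qpow h (-1) * qpow h (l - m) := by
      rw [← qpow_add]; congr 1; push_cast; ring
    rw [h1]
  · rw [← sub_smul, smul_smul, ← qnum_comm, sub_smul]
    rcases m with _ | m
    · simp [qnum]
    · have h1 : (2 * l - (m + 1 : ℕ) : ℂ) = 2 * l - ((m + 1 : ℕ) + 1 : ℕ) + 1 := by
        push_cast; ring
      simp only [Nat.add_sub_cancel]
      rw [← Nat.cast_add_one, ← h1]

/-- The Verma module `M_l` of highest weight `l` (spin normalization), as a representation. -/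
def verma (h l : ℂ) : Uq h →ₐ[ℂ] Module.End ℂ V :=
  RingQuot.liftAlgHom ℂ ⟨FreeAlgebra.lift ℂ (vermaGen h l), vermaGen_rel h l⟩

/-- The tensor product `M_{l₁} ⊗ M_{l₂}`, on which `U_q(sl₂)` acts through the coproduct. -/
def tensorRep (h l₁ l₂ : ℂ) : Uq h →ₐ[ℂ] Module.End ℂ (V ⊗[ℂ] V) :=
  (Module.endTensorEndAlgHom (R := ℂ) (S := ℂ) (A := ℂ) (M := V) (N := V)).comp
    ((Algebra.TensorProduct.map (verma h l₁) (verma h l₂)).comp (comul h))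

/-! ### Embeddings of Verma modules (the `q3j`-symbols) -/

/-- The squared norm of `e^l_{l - m}` for the contravariant form:
`[m]! [2 l] [2 l - 1] ⋯ [2 l - m + 1]`. -/
def normSq (h l : ℂ) (m : ℕ) : ℂ := qfact h m * ∏ j ∈ Finset.range m, qnum h (2 * l - j)

/-- The normalization factor `Δ(l₁, l₂, l₁₂)`, `l₁₂ = l₁ + l₂ - n`: the principal square root of
`[n]! ∏_{j < n} [2 l₁ - j] [2 l₂ - j] / [2 l₁₂ + 2 + j]`. -/
def triangle (h l₁ l₂ : ℂ) (n : ℕ) : ℂ :=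
  (qfact h n * ∏ j ∈ Finset.range n,
    (qnum h (2 * l₁ - j) * qnum h (2 * l₂ - j) /
      qnum h (2 * (l₁ + l₂ - n) + 2 + j))) ^ (1 / 2 : ℂ)

/-- The normalized highest weight vector of weight `l₁₂ = l₁ + l₂ - n` in `M_{l₁} ⊗ M_{l₂}`. -/
def hwv (h l₁ l₂ : ℂ) (n : ℕ) : V ⊗[ℂ] V :=
  ∑ i ∈ Finset.range (n + 1),
    ((-1) ^ i * triangle h l₁ l₂ n *
      qpow h ((l₁ - i) * (l₁ + l₂ - n + 1) +
        (l₂ * (l₂ + 1) - l₁ * (l₁ + 1) - (l₁ + l₂ - n) * (l₁ + l₂ - n + 1)) / 2) /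
      (normSq h l₁ i * normSq h l₂ (n - i))) • (e i ⊗ₜ[ℂ] e (n - i))

/-- The embedding `ψ : M_{l₁₂} → M_{l₁} ⊗ M_{l₂}`, `l₁₂ = l₁ + l₂ - n`, sending the highest weight
vector to the normalized highest weight vector `hwv`, and `F ^ m` times the former to `F ^ m` times
the latter. Its matrix elements are the `q3j`-symbols. -/
def psi (h l₁ l₂ : ℂ) (n : ℕ) : V →ₗ[ℂ] V ⊗[ℂ] V :=
  Finsupp.linearCombination ℂ fun m : ℕ =>
    tensorRep h l₁ l₂ (Uq.of h .F ^ m) (hwv h l₁ l₂ n)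

/-! ### The `q6j`-symbols

For weights `l₁, l₂, l₃` write `l = l₁ + l₂ + l₃ - N`, `l₁₂ = l₁ + l₂ - n₁₂`,
`l₂₃ = l₂ + l₃ - n₂₃` with natural numbers `n₁₂, n₂₃ ≤ N`; so `l₁₂ + l₃ - l = N - n₁₂` and
`l₁ + l₂₃ - l = N - n₂₃`. -/

/-- The embedding `M_l → M_{l₁₂} ⊗ M_{l₃} → (M_{l₁} ⊗ M_{l₂}) ⊗ M_{l₃}`; it sends `e^l_a` to
`e^{l₁₂, l}_a`. -/
def leftEmb (h l₁ l₂ l₃ : ℂ) (N : ℕ) (n₁₂ : Fin (N + 1)) : V →ₗ[ℂ] V ⊗[ℂ] (V ⊗[ℂ] V) :=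
  (TensorProduct.assoc ℂ V V V).toLinearMap ∘ₗ
    (psi h l₁ l₂ n₁₂).rTensor V ∘ₗ psi h (l₁ + l₂ - (n₁₂ : ℕ)) l₃ (N - n₁₂)

/-- The embedding `M_l → M_{l₁} ⊗ M_{l₂₃} → M_{l₁} ⊗ (M_{l₂} ⊗ M_{l₃})`; it sends `e^l_a` to
`e^{l₂₃, l}_a`. -/
def rightEmb (h l₁ l₂ l₃ : ℂ) (N : ℕ) (n₂₃ : Fin (N + 1)) : V →ₗ[ℂ] V ⊗[ℂ] (V ⊗[ℂ] V) :=
  (psi h l₂ l₃ n₂₃).lTensor V ∘ₗ psi h l₁ (l₂ + l₃ - (n₂₃ : ℕ)) (N - n₂₃)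

/-- `c` expands the vectors `e^{l₁₂, l}_a` in the vectors `e^{l₂₃, l}_a`:
`e^{l₁₂, l}_a = ∑_{l₂₃} c_{l₂₃} e^{l₂₃, l}_a` for all `a`. -/
def IsExpansion (h l₁ l₂ l₃ : ℂ) (N : ℕ) (n₁₂ : Fin (N + 1)) (c : Fin (N + 1) → ℂ) : Prop :=
  leftEmb h l₁ l₂ l₃ N n₁₂ = ∑ n₂₃, c n₂₃ • rightEmb h l₁ l₂ l₃ N n₂₃

/-- The `q6j`-symbol `{l₁ l₂ l₁₂; l₃ l l₂₃}`: the coefficient of `e^{l₂₃, l}_a` in the expansion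
of `e^{l₁₂, l}_a`. -/
def sixJ (h l₁ l₂ l₃ : ℂ) (N : ℕ) (n₁₂ n₂₃ : Fin (N + 1)) : ℂ :=
  Classical.epsilon (IsExpansion h l₁ l₂ l₃ N n₁₂) n₂₃

end QSixJ

end

noncomputable section

namespace QSixJ

/-! ### Quantum numbers -/

/-! The identity is the hexagon for moving `M_{l₃}` past `M_{l₁} ⊗ M_{l₂}`, but no R-matrix is
constructed. A vector of a triple tensor product killed by `E` is determined by its component at the
highest weight vector `e 0` of the last factor (`eq_zero_of_E_eq_zero`,
`eq_zero_of_lTensor_lastCoord`). On such components the braiding only rescales: the `e 0`-components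
of `ψ` for `(l₁, l₂)` and `(l₂, l₁)` are proportional with factor `hwvRatio`, up to the diagonal
operator `twist`.

Let `A`, `B`, `C` be the matrices of q6j-symbols for the orders `(l₁, l₂, l₃)`, `(l₃, l₁, l₂)`,
`(l₁, l₃, l₂)`. The `e 0`-component of `M_{l₃}` in the `C`-expansion is computed in two ways.
`twist_rightEmb` turns one side into components for the order `(l₁, l₂, l₃)`. On the other side
`twist_leftEmb` passes to the order `(l₃, l₁, l₂)`, then come the `B`-expansion,
`lTensor_lastCoord_leftEmb_eq_smul` and the `A`-expansion. Comparing coefficients gives `u B s⁻¹ A =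
C w⁻¹` with diagonal `u`, `s`, `w` (`sixJMatrix_mul_mul`).

This has the inverse of the wanted middle factor. The matrices are orthogonal
(`sixJMatrix_mul_transpose`), so taking the inverse transpose gives `B s A = u C w`
(`racah_matrix`), and `racah` evaluates `u`, `s`, `w`. Orthogonality comes from the contravariant
form: by the q-Vandermonde identity the square-root normalization makes `ψ` an isometry
(`sum_hwvCoeff_sq`, `form₂_psi`). Existence of the expansions is a dimension count in a weight space
of dimension at most `N + 1` (`existsUnique_isExpansion`). -/

theorem qpow_ne_zero (h x : ℂ) : qpow h x ≠ 0 := Complex.exp_ne_zero _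

theorem qnum_zero (h : ℂ) : qnum h 0 = 0 := by simp [qnum]

theorem qnum_add (h x y : ℂ) :
    qnum h (x + y) = qpow h y * qnum h x + qpow h (-x) * qnum h y := by
  simp only [qnum, mul_div_assoc', ← add_div, mul_sub, ← qpow_add]
  ring_nf

theorem qnum_natCast_ne_zero {h : ℂ} (hq : NotRootOfUnity h) {n : ℕ} (hn : 0 < n) :
    qnum h n ≠ 0 := by
  have key : ∀ m : ℕ, 0 < m → qpow h m - qpow h (-m) ≠ 0 := by
    intro m hm h0
    -- If `q ^ m = q ^ (-m)`, then `q ^ (2 m) = 1`.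
    apply hq (2 * m) (by omega)
    have h1 : qpow h m * qpow h m = 1 := by
      nth_rw 2 [sub_eq_zero.mp h0]
      exact qpow_mul_neg h m
    rw [← Complex.exp_nat_mul, ← h1, ← qpow_add, qpow]
    push_cast; ring_nf
  refine div_ne_zero (key n hn) ?_
  simpa using key 1 one_pos

theorem qfact_succ (h : ℂ) (n : ℕ) : qfact h (n + 1) = qfact h n * qnum h (n + 1) := by
  rw [qfact, Finset.prod_range_succ, qfact]

theorem qfact_ne_zero {h : ℂ} (hq : NotRootOfUnity h) (n : ℕ) : qfact h n ≠ 0 :=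
  Finset.prod_ne_zero_iff.mpr fun j _ => by
    simpa using qnum_natCast_ne_zero hq (Nat.succ_pos j)

/-- Genericity depends only on `2 l` modulo `ℤ`. This moves it between `l₁₃`, `l₂₃`, `l₁₂₃` and the
corresponding sums of weights. -/
theorem Generic.add_int {h l : ℂ} (g : Generic h l) (k : ℤ) : Generic h (l + k) := fun j => by
  have := g (2 * k + j)
  push_cast at this
  rwa [← add_assoc, ← mul_add] at this

theorem Generic.sub_nat {h l : ℂ} (g : Generic h l) (k : ℕ) : Generic h (l - k) := by
  simpa [sub_eq_add_neg] using g.add_int (-k)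

theorem Generic.qnum_sub_nat {h l : ℂ} (g : Generic h l) (k : ℕ) : qnum h (2 * l - k) ≠ 0 := by
  simpa [sub_eq_add_neg] using g (-k)

theorem normSq_succ (h l : ℂ) (m : ℕ) :
    normSq h l (m + 1) = qnum h (m + 1) * qnum h (2 * l - m) * normSq h l m := by
  rw [normSq, normSq, qfact_succ, Finset.prod_range_succ]; ring

theorem normSq_zero (h l : ℂ) : normSq h l 0 = 1 := by simp [normSq, qfact]

theorem normSq_ne_zero {h l : ℂ} (hq : NotRootOfUnity h) (g : Generic h l) (m : ℕ) :
    normSq h l m ≠ 0 :=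
  mul_ne_zero (qfact_ne_zero hq m) (Finset.prod_ne_zero_iff.mpr fun j _ => g.qnum_sub_nat j)

/-! ### The `q`-Vandermonde identity -/

/-- The divided rising factorial `[a] [a + 1] ⋯ [a + k - 1] / [k]!`. -/
def qrising (h a : ℂ) (k : ℕ) : ℂ := (∏ j ∈ Finset.range k, qnum h (a + j)) / qfact h k

theorem qrising_zero (h a : ℂ) : qrising h a 0 = 1 := by simp [qrising, qfact]

theorem qnum_mul_qrising_succ {h : ℂ} (hq : NotRootOfUnity h) (a : ℂ) (k : ℕ) :
    qnum h (k + 1) * qrising h a (k + 1) = qnum h (a + k) * qrising h a k := by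
  have h1 := qfact_ne_zero hq k
  have h2 : qnum h ((k : ℂ) + 1) ≠ 0 := by simpa using qnum_natCast_ne_zero hq (Nat.succ_pos k)
  rw [qrising, qrising, qfact_succ, Finset.prod_range_succ]
  field_simp

/-- The q-Vandermonde identity, by induction on `n`: after multiplication by `[n + 1]`, this factor
splits by `qnum_add`, each half lowers one index, and the halves recombine through `[a + b + n] =
[(a + p.2) + (b + p.1)]`. The boundary terms drop out because `[0] = 0`. -/
theorem sum_antidiagonal_qrising {h : ℂ} (hq : NotRootOfUnity h) (a b : ℂ) (n : ℕ) :
    ∑ p ∈ Finset.HasAntidiagonal.antidiagonal n,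
      qpow h (p.2 * b - p.1 * a) * qrising h a p.2 * qrising h b p.1 = qrising h (a + b) n := by
  induction n with
  | zero => simp [qrising_zero, qpow_zero]
  | succ n ih =>
    have h2 : qnum h ((n : ℂ) + 1) ≠ 0 := by simpa using qnum_natCast_ne_zero hq (Nat.succ_pos n)
    apply mul_left_cancel₀ h2
    rw [qnum_mul_qrising_succ hq, ← ih, Finset.mul_sum, Finset.mul_sum]
    have h3 : ∀ p ∈ Finset.HasAntidiagonal.antidiagonal (n + 1), qnum h ((n : ℂ) + 1) *
        (qpow h (p.2 * b - p.1 * a) * qrising h a p.2 * qrising h b p.1) =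
        qpow h p.1 * qpow h (p.2 * b - p.1 * a) * (qnum h p.2 * qrising h a p.2) *
          qrising h b p.1 +
        qpow h (-p.2) * qpow h (p.2 * b - p.1 * a) * (qnum h p.1 * qrising h b p.1) *
          qrising h a p.2 := by
      intro p hp
      have h4 : ((n : ℂ) + 1) = p.2 + p.1 := by
        rw [Finset.HasAntidiagonal.mem_antidiagonal] at hp
        rw [add_comm (p.2 : ℂ)]; exact_mod_cast hp.symm
      rw [h4, qnum_add]; ring
    rw [Finset.sum_congr rfl h3, Finset.sum_add_distrib,
      Finset.Nat.sum_antidiagonal_succ', Finset.Nat.sum_antidiagonal_succ]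
    simp only [Nat.cast_zero, qnum_zero, zero_mul, mul_zero, zero_add]
    rw [← Finset.sum_add_distrib]
    refine Finset.sum_congr rfl fun p hp => ?_
    have h4 : a + b + n = (a + p.2) + (b + p.1) := by
      rw [Finset.HasAntidiagonal.mem_antidiagonal] at hp
      rw [← hp]; push_cast; ring
    push_cast
    have h5 : qpow h p.1 * qpow h ((p.2 + 1) * b - p.1 * a) =
        qpow h (b + p.1) * qpow h (p.2 * b - p.1 * a) := by
      rw [← qpow_add, ← qpow_add]; ring_nf
    have h6 : qpow h (-p.2) * qpow h (p.2 * b - (p.1 + 1) * a) =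
        qpow h (-(a + p.2)) * qpow h (p.2 * b - p.1 * a) := by
      rw [← qpow_add, ← qpow_add]; ring_nf
    rw [qnum_mul_qrising_succ hq, qnum_mul_qrising_succ hq, h4, qnum_add h (a + p.2), h5, h6]
    ring

/-- Reading the last `j` factors of a falling product backwards gives a rising product. This
converts the falling products in `normSq` into `qrising`. -/
theorem prod_range_add_qnum_sub (h A : ℂ) (i j : ℕ) :
    ∏ m ∈ Finset.range (i + j), qnum h (A - m) =
      (∏ m ∈ Finset.range i, qnum h (A - m)) *
        ∏ k ∈ Finset.range j, qnum h (A - (i + j : ℕ) + 1 + k) := by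
  rw [Finset.prod_range_add, ← Finset.prod_range_reflect (fun k : ℕ => qnum h (A - (i + k : ℕ)))]
  congr 1
  refine Finset.prod_congr rfl fun k hk => ?_
  rw [Finset.mem_range] at hk
  congr 1
  have : ((j - 1 - k : ℕ) : ℂ) = j - 1 - k := by
    rw [Nat.cast_sub (by omega), Nat.cast_sub (by omega)]; simp
  push_cast [this]; ring

/-! ### Coefficients of the highest weight vectors -/

/-- The exponent of `q` in the coefficients of `hwv`. -/
def hwvExp (l₁ l₂ : ℂ) (n i : ℕ) : ℂ :=
  (l₁ - i) * (l₁ + l₂ - n + 1) +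
    (l₂ * (l₂ + 1) - l₁ * (l₁ + 1) - (l₁ + l₂ - n) * (l₁ + l₂ - n + 1)) / 2

/-- The coefficient of `e i ⊗ e (n - i)` in `hwv`. -/
def hwvCoeff (h l₁ l₂ : ℂ) (n i : ℕ) : ℂ :=
  (-1) ^ i * triangle h l₁ l₂ n * qpow h (hwvExp l₁ l₂ n i) /
    (normSq h l₁ i * normSq h l₂ (n - i))

theorem hwv_eq_sum (h l₁ l₂ : ℂ) (n : ℕ) :
    hwv h l₁ l₂ n = ∑ i ∈ Finset.range (n + 1), hwvCoeff h l₁ l₂ n i • (e i ⊗ₜ[ℂ] e (n - i)) :=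
  rfl

/-- The radicand is symmetric, so both tensor orders use the same square root and no sign ambiguity
enters `hwvRatio`. -/
theorem triangle_comm (h l₁ l₂ : ℂ) (n : ℕ) : triangle h l₁ l₂ n = triangle h l₂ l₁ n := by
  simp only [triangle, add_comm l₁ l₂, mul_comm (qnum h (2 * l₁ - _))]

theorem triangle_sq (h l₁ l₂ : ℂ) (n : ℕ) :
    triangle h l₁ l₂ n ^ 2 = qfact h n * ∏ j ∈ Finset.range n,
    (qnum h (2 * l₁ - j) * qnum h (2 * l₂ - j) /
      qnum h (2 * (l₁ + l₂ - n) + 2 + j)) := by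
  rw [triangle, ← Complex.cpow_nat_mul]; simp

/-- The highest weight vector has norm 1. After the factor `[n]! / P` is taken out, the summands are
those of the q-Vandermonde sum with `a = 2 l₁ - n + 1` and `b = 2 l₂ - n + 1`, whose value is `P /
[n]!`. -/
theorem sum_hwvCoeff_sq {h l₁ l₂ : ℂ} (hq : NotRootOfUnity h) (g₁ : Generic h l₁)
    (g₂ : Generic h l₂) (g : Generic h (l₁ + l₂)) (n : ℕ) :
    ∑ i ∈ Finset.range (n + 1),
      hwvCoeff h l₁ l₂ n i ^ 2 * (normSq h l₁ i * normSq h l₂ (n - i)) = 1 := by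
  set a := 2 * l₁ - n + 1
  set b := 2 * l₂ - n + 1
  set P₁ := ∏ j ∈ Finset.range n, qnum h (2 * l₁ - j)
  set P₂ := ∏ j ∈ Finset.range n, qnum h (2 * l₂ - j)
  set P := ∏ j ∈ Finset.range n, qnum h (a + b + j)
  have hP₁ : P₁ ≠ 0 := Finset.prod_ne_zero_iff.mpr fun j _ => g₁.qnum_sub_nat j
  have hP₂ : P₂ ≠ 0 := Finset.prod_ne_zero_iff.mpr fun j _ => g₂.qnum_sub_nat j
  have hP : P ≠ 0 := Finset.prod_ne_zero_iff.mpr fun j _ => by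
    have := g (2 - 2 * n + j)
    push_cast at this
    convert this using 2
    simp only [a, b]; ring
  have hn := qfact_ne_zero hq n
  have hT : triangle h l₁ l₂ n ^ 2 = qfact h n * (P₁ * P₂ / P) := by
    have hP' : ∏ j ∈ Finset.range n, qnum h (2 * (l₁ + l₂ - n) + 2 + j) = P :=
      Finset.prod_congr rfl fun j _ => by congr 1; simp only [a, b]; ring
    rw [triangle_sq, Finset.prod_div_distrib, Finset.prod_mul_distrib, hP']
  have key := sum_antidiagonal_qrising hq a b n
  rw [Finset.Nat.sum_antidiagonal_eq_sum_range_succ_mk] at key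
  have h1 : ∀ i ∈ Finset.range (n + 1),
      hwvCoeff h l₁ l₂ n i ^ 2 * (normSq h l₁ i * normSq h l₂ (n - i)) =
      (qfact h n / P) * (qpow h ((n - i : ℕ) * b - i * a) * qrising h a (n - i) *
        qrising h b i) := by
    intro i hi
    obtain ⟨j, rfl⟩ := Nat.exists_eq_add_of_le (Nat.lt_succ_iff.mp (Finset.mem_range.mp hi))
    have e1 := prod_range_add_qnum_sub h (2 * l₁) i j
    have e2 := prod_range_add_qnum_sub h (2 * l₂) j i
    rw [add_comm j i] at e2
    have n1 := normSq_ne_zero hq g₁ i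
    have n2 := normSq_ne_zero hq g₂ j
    have hx : qpow h (hwvExp l₁ l₂ (i + j) i) ^ 2 = qpow h (j * b - i * a) := by
      rw [pow_two, ← qpow_add]; congr 1
      simp only [hwvExp, a, b]; push_cast; ring
    have hfi := qfact_ne_zero hq i
    have hfj := qfact_ne_zero hq j
    have m1 : (∏ m ∈ Finset.range i, qnum h (2 * l₁ - m)) ≠ 0 := right_ne_zero_of_mul n1
    have m2 : (∏ m ∈ Finset.range j, qnum h (2 * l₂ - m)) ≠ 0 := right_ne_zero_of_mul n2
    rw [hwvCoeff, Nat.add_sub_cancel_left, div_pow, mul_pow, mul_pow, hT, hx, ← pow_mul,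
      mul_comm i 2, pow_mul, neg_one_sq, one_pow, one_mul]
    simp only [P₁, P₂, e1, e2, qrising, normSq]
    field_simp
    simp only [a, b]
    ring
  rw [Finset.sum_congr rfl h1, ← Finset.mul_sum, key, qrising]
  field_simp
  rfl

/-- The left side is the coefficient of `e i ⊗ e j` in `E` applied to `hwv`. -/
theorem hwvCoeff_succ {h l₁ l₂ : ℂ} (hq : NotRootOfUnity h) (g₁ : Generic h l₁)
    (g₂ : Generic h l₂) (i j : ℕ) :
    hwvCoeff h l₁ l₂ (i + j + 1) (i + 1) * (qnum h (i + 1) * qnum h (2 * l₁ - i)) *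
        qpow h (l₂ - j) +
      hwvCoeff h l₁ l₂ (i + j + 1) i * (qnum h (j + 1) * qnum h (2 * l₂ - j)) *
        qpow h (-(l₁ - i)) = 0 := by
  have n1 := normSq_ne_zero hq g₁ (i + 1)
  have n2 := normSq_ne_zero hq g₂ (j + 1)
  have n3 := normSq_ne_zero hq g₁ i
  have n4 := normSq_ne_zero hq g₂ j
  have hx : qpow h (hwvExp l₁ l₂ (i + j + 1) (i + 1)) * qpow h (l₂ - j) =
      qpow h (hwvExp l₁ l₂ (i + j + 1) i) * qpow h (-(l₁ - i)) := by
    rw [← qpow_add, ← qpow_add]; congr 1; simp only [hwvExp]; push_cast; ring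
  rw [hwvCoeff, hwvCoeff, show i + j + 1 - (i + 1) = j by omega,
    show i + j + 1 - i = j + 1 by omega]
  rw [normSq_succ] at n1 n2 ⊢
  rw [normSq_succ]
  have n5 := left_ne_zero_of_mul n1
  have n6 := left_ne_zero_of_mul n2
  have n51 := left_ne_zero_of_mul n5
  have n52 := right_ne_zero_of_mul n5
  have n61 := left_ne_zero_of_mul n6
  have n62 := right_ne_zero_of_mul n6
  field_simp
  rw [pow_succ, mul_right_comm, mul_assoc _ (qpow h (l₂ - j)), mul_comm (qpow h (l₂ - j)), hx]
  ring

/-- The ratio of the extremal coefficients of `hwv h l₁ l₂ n` and `hwv h l₂ l₁ n`. -/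
def hwvRatio (h l₁ l₂ : ℂ) (n : ℕ) : ℂ :=
  (-1) ^ n * qpow h (-((2 * l₂ - (l₁ + l₂ - n)) * (l₁ + l₂ - n + 1)
    + l₁ * (l₁ + 1) - l₂ * (l₂ + 1)))

theorem hwvRatio_ne_zero (h l₁ l₂ : ℂ) (n : ℕ) : hwvRatio h l₁ l₂ n ≠ 0 :=
  mul_ne_zero (pow_ne_zero _ (by norm_num)) (qpow_ne_zero _ _)

/-- Both coefficients belong to the term in which the factor of weight `l₂` is at its highest weight
vector, so their ratio is what the braiding contributes there. -/
theorem hwvCoeff_self (h l₁ l₂ : ℂ) (n : ℕ) :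
    hwvCoeff h l₁ l₂ n n = hwvRatio h l₁ l₂ n * hwvCoeff h l₂ l₁ n 0 := by
  have hx : qpow h (hwvExp l₁ l₂ n n) = qpow h (-((2 * l₂ - (l₁ + l₂ - n)) * (l₁ + l₂ - n + 1)
      + l₁ * (l₁ + 1) - l₂ * (l₂ + 1))) * qpow h (hwvExp l₂ l₁ n 0) := by
    rw [← qpow_add]; congr 1; simp only [hwvExp]; push_cast; ring
  rw [hwvCoeff, hwvCoeff, hwvRatio, hx, triangle_comm h l₂ l₁, Nat.sub_self, Nat.sub_zero,
    normSq_zero]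
  ring

/-! ### Representations, tensor products and intertwiners -/

section Rep

variable {h : ℂ} {M M' N P : Type*} [AddCommMonoid M] [Module ℂ M] [AddCommMonoid N] [Module ℂ N]
  [AddCommMonoid M'] [Module ℂ M'] [AddCommMonoid P] [Module ℂ P]

/-- The tensor product of two representations of `U_q(sl₂)`. -/
def tens (ρ : Uq h →ₐ[ℂ] Module.End ℂ M) (σ : Uq h →ₐ[ℂ] Module.End ℂ N) :
    Uq h →ₐ[ℂ] Module.End ℂ (M ⊗[ℂ] N) :=
  (Module.endTensorEndAlgHom (R := ℂ) (S := ℂ) (A := ℂ) (M := M) (N := N)).comp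
    ((Algebra.TensorProduct.map ρ σ).comp (comul h))

theorem tensorRep_eq_tens (h l₁ l₂ : ℂ) :
    tensorRep h l₁ l₂ = tens (verma h l₁) (verma h l₂) := rfl

theorem comul_of (h : ℂ) (g : Gen) : comul h (Uq.of h g) = comulGen h g := by
  rw [comul, Uq.of, RingQuot.liftAlgHom_mkAlgHom_apply, gen, FreeAlgebra.lift_ι_apply]

theorem verma_of (h l : ℂ) (g : Gen) : verma h l (Uq.of h g) = vermaGen h l g := by
  rw [verma, Uq.of, RingQuot.liftAlgHom_mkAlgHom_apply, gen, FreeAlgebra.lift_ι_apply]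

variable (ρ : Uq h →ₐ[ℂ] Module.End ℂ M) (ρ' : Uq h →ₐ[ℂ] Module.End ℂ M')
  (σ : Uq h →ₐ[ℂ] Module.End ℂ N)
  (τ : Uq h →ₐ[ℂ] Module.End ℂ P)

theorem tens_E : tens ρ σ (Uq.of h .E) =
    TensorProduct.map (ρ (Uq.of h .E)) (σ (Uq.of h .K)) +
      TensorProduct.map (ρ (Uq.of h .Kinv)) (σ (Uq.of h .E)) := by
  simp only [tens, AlgHom.comp_apply, comul_of, comulGen, map_add, Algebra.TensorProduct.map_tmul]
  rfl

theorem tens_F : tens ρ σ (Uq.of h .F) =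
    TensorProduct.map (ρ (Uq.of h .F)) (σ (Uq.of h .K)) +
      TensorProduct.map (ρ (Uq.of h .Kinv)) (σ (Uq.of h .F)) := by
  simp only [tens, AlgHom.comp_apply, comul_of, comulGen, map_add, Algebra.TensorProduct.map_tmul]
  rfl

theorem tens_K : tens ρ σ (Uq.of h .K) =
    TensorProduct.map (ρ (Uq.of h .K)) (σ (Uq.of h .K)) := by
  simp only [tens, AlgHom.comp_apply, comul_of, comulGen, Algebra.TensorProduct.map_tmul]
  rfl

theorem tens_Kinv : tens ρ σ (Uq.of h .Kinv) =
    TensorProduct.map (ρ (Uq.of h .Kinv)) (σ (Uq.of h .Kinv)) := by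
  simp only [tens, AlgHom.comp_apply, comul_of, comulGen, Algebra.TensorProduct.map_tmul]
  rfl

/-- Written without subtraction, since the modules carry only an additive monoid structure. -/
theorem rep_E_F (x : M) : ρ (Uq.of h .E) (ρ (Uq.of h .F) x) +
      (qpow h 1 - qpow h (-1))⁻¹ • ρ (Uq.of h .Kinv) (ρ (Uq.of h .Kinv) x) =
    ρ (Uq.of h .F) (ρ (Uq.of h .E) x) +
      (qpow h 1 - qpow h (-1))⁻¹ • ρ (Uq.of h .K) (ρ (Uq.of h .K) x) := by
  have h1 : Uq.of h .E * Uq.of h .F +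
        (qpow h 1 - qpow h (-1))⁻¹ • (Uq.of h .Kinv * Uq.of h .Kinv) =
      Uq.of h .F * Uq.of h .E + (qpow h 1 - qpow h (-1))⁻¹ • (Uq.of h .K * Uq.of h .K) := by
    rw [sub_eq_iff_eq_add.mp (Uq.E_F h), smul_sub]
    abel
  simpa using congrArg (fun u => ρ u x) h1

theorem rep_K_F (x : M) : ρ (Uq.of h .K) (ρ (Uq.of h .F) x) =
    qpow h (-1) • ρ (Uq.of h .F) (ρ (Uq.of h .K) x) := by
  simpa using congrArg (fun u => ρ u x) (Uq.K_F h)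

theorem rep_K_Kinv (x : M) : ρ (Uq.of h .K) (ρ (Uq.of h .Kinv) x) = x := by
  simpa using congrArg (fun u => ρ u x) (Uq.K_Kinv h)

theorem rep_Kinv_K (x : M) : ρ (Uq.of h .Kinv) (ρ (Uq.of h .K) x) = x := by
  simpa using congrArg (fun u => ρ u x) (Uq.Kinv_K h)

/-- A linear map that commutes with the action of the generators. -/
def Intertwines (f : M →ₗ[ℂ] N) : Prop :=
  ∀ g : Gen, f ∘ₗ ρ (Uq.of h g) = σ (Uq.of h g) ∘ₗ f

variable {ρ ρ' σ τ}

theorem Intertwines.apply {f : M →ₗ[ℂ] N} (hf : Intertwines ρ σ f) (g : Gen) (x : M) :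
    f (ρ (Uq.of h g) x) = σ (Uq.of h g) (f x) := LinearMap.congr_fun (hf g) x

theorem Intertwines.rTensor {f : M →ₗ[ℂ] M'} (hf : Intertwines ρ ρ' f) :
    Intertwines (tens ρ σ) (tens ρ' σ) (f.rTensor N) := by
  rintro (_ | _ | _ | _) <;> ext x y <;> simp [tens_E, tens_F, tens_K, tens_Kinv, hf.apply]

theorem Intertwines.lTensor {f : M →ₗ[ℂ] M'} (hf : Intertwines ρ ρ' f) :
    Intertwines (tens σ ρ) (tens σ ρ') (f.lTensor N) := by
  rintro (_ | _ | _ | _) <;> ext x y <;> simp [tens_E, tens_F, tens_K, tens_Kinv, hf.apply]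

theorem intertwines_assoc : Intertwines (tens (tens ρ σ) τ) (tens ρ (tens σ τ))
    (TensorProduct.assoc ℂ M N P).toLinearMap := by
  rintro (_ | _ | _ | _) <;> ext x y z <;>
    simp [tens_E, tens_F, tens_K, tens_Kinv, TensorProduct.add_tmul, TensorProduct.tmul_add,
      add_assoc]

/-! ### Components at the highest weight vector of a Verma factor -/

variable (M) in
/-- The coefficient of `e k` in the last tensor factor. -/
def lastCoord (k : ℕ) : M ⊗[ℂ] V →ₗ[ℂ] M :=
  (TensorProduct.rid ℂ M).toLinearMap ∘ₗ (Finsupp.lapply k : V →ₗ[ℂ] ℂ).lTensor M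

variable (M) in
/-- The coefficient of `e 0` in the first tensor factor. -/
def firstCoord : V ⊗[ℂ] M →ₗ[ℂ] M :=
  (TensorProduct.lid ℂ M).toLinearMap ∘ₗ (Finsupp.lapply 0 : V →ₗ[ℂ] ℂ).rTensor M

@[simp]
theorem lastCoord_tmul (k : ℕ) (x : M) (y : V) : lastCoord M k (x ⊗ₜ y) = y k • x := by
  simp [lastCoord]

@[simp]
theorem firstCoord_tmul (x : M) (y : V) : firstCoord M (y ⊗ₜ x) = y 0 • x := by
  simp [firstCoord]

theorem eq_zero_of_lastCoord {v : M ⊗[ℂ] V} (hv : ∀ k, lastCoord M k v = 0) : v = 0 := by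
  have key : ∀ (w : M ⊗[ℂ] V) (k : ℕ),
      TensorProduct.finsuppScalarRight ℂ ℂ M ℕ w k = lastCoord M k w := by
    intro w k
    induction w using TensorProduct.induction_on with
    | zero => simp
    | tmul x y => simp [TensorProduct.finsuppScalarRight_apply_tmul_apply]
    | add x y hx hy => simp [hx, hy]
  apply (TensorProduct.finsuppScalarRight ℂ ℂ M ℕ).injective
  ext k
  rw [key, hv, map_zero, Finsupp.zero_apply]

/-- Only `F ⊗ K` contributes: the image of `F` in the last factor has no `e 0`-component. -/
theorem lastCoord_comp_F (l : ℂ) : lastCoord M 0 ∘ₗ tens ρ (verma h l) (Uq.of h .F) =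
    qpow h l • (ρ (Uq.of h .F) ∘ₗ lastCoord M 0) := by
  ext x k
  rcases k with _ | k <;> simp [tens_F, verma_of, vermaGen_F, vermaGen_K]

theorem firstCoord_comp_F (l : ℂ) : firstCoord M ∘ₗ tens (verma h l) ρ (Uq.of h .F) =
    qpow h (-l) • (ρ (Uq.of h .F) ∘ₗ firstCoord M) := by
  ext k x
  rcases k with _ | k <;> simp [tens_F, verma_of, vermaGen_F, vermaGen_Kinv]

theorem lastCoord_comp_E (l : ℂ) (k : ℕ) : lastCoord M k ∘ₗ tens ρ (verma h l) (Uq.of h .E) =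
    qpow h (l - k) • (ρ (Uq.of h .E) ∘ₗ lastCoord M k) +
    (qnum h (k + 1) * qnum h (2 * l - k)) • (ρ (Uq.of h .Kinv) ∘ₗ lastCoord M (k + 1)) := by
  ext x m
  rcases m with _ | m
  · by_cases hk : k = 0
    · subst hk; simp [tens_E, verma_of, vermaGen_E, vermaGen_K, qnum_zero]
    · simp [tens_E, verma_of, vermaGen_E, vermaGen_K, qnum_zero, hk]
  · by_cases hk : m = k
    · subst hk
      simp [tens_E, verma_of, vermaGen_E, vermaGen_K]
      ring_nf
    · by_cases hk' : m + 1 = k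
      · subst hk'; simp [tens_E, verma_of, vermaGen_E, vermaGen_K]
      · simp [tens_E, verma_of, vermaGen_E, vermaGen_K, hk, hk']

/-- A vector of `M ⊗ M_l` killed by `E` is determined by its component at `e 0`. -/
theorem eq_zero_of_E_eq_zero {l : ℂ} (hq : NotRootOfUnity h) (gl : Generic h l) {v : M ⊗[ℂ] V}
    (hE : tens ρ (verma h l) (Uq.of h .E) v = 0) (h0 : lastCoord M 0 v = 0) : v = 0 := by
  refine eq_zero_of_lastCoord fun k => ?_
  induction k with
  | zero => exact h0
  | succ k ih =>
    -- If the `k`-th component vanishes, the `k`-th component of `E v = 0` reads `[k + 1] [2 l - k]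
    -- K⁻¹ v_{k + 1} = 0`, and both quantum numbers are nonzero.
    have h1 := LinearMap.congr_fun (lastCoord_comp_E (ρ := ρ) l k) v
    simp only [LinearMap.comp_apply, hE, map_zero, LinearMap.add_apply, LinearMap.smul_apply, ih,
      smul_zero, zero_add] at h1
    have h2 : qnum h ((k : ℂ) + 1) ≠ 0 := by
      simpa using qnum_natCast_ne_zero hq (Nat.succ_pos k)
    rw [eq_comm, smul_eq_zero_iff_right (mul_ne_zero h2 (gl.qnum_sub_nat k))] at h1
    rw [← rep_K_Kinv ρ (lastCoord M (k + 1) v), h1, map_zero]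

end Rep

/-! ### The embeddings of Verma modules -/

theorem tensorRep_E_hwv {h l₁ l₂ : ℂ} (hq : NotRootOfUnity h) (g₁ : Generic h l₁)
    (g₂ : Generic h l₂) (n : ℕ) :
    tensorRep h l₁ l₂ (Uq.of h .E) (hwv h l₁ l₂ n) = 0 := by
  have h1 : ∀ i ∈ Finset.range (n + 1),
      tensorRep h l₁ l₂ (Uq.of h .E) (hwvCoeff h l₁ l₂ n i • (e i ⊗ₜ[ℂ] e (n - i))) =
      (hwvCoeff h l₁ l₂ n i * (qnum h i * qnum h (2 * l₁ - i + 1)) * qpow h (l₂ - (n - i : ℕ))) •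
          (e (i - 1) ⊗ₜ[ℂ] e (n - i)) +
        (hwvCoeff h l₁ l₂ n i * (qnum h (n - i : ℕ) * qnum h (2 * l₂ - (n - i : ℕ) + 1)) *
          qpow h (-(l₁ - i))) • (e i ⊗ₜ[ℂ] e (n - i - 1)) := by
    intro i _
    simp only [map_smul, tensorRep_eq_tens, tens_E, LinearMap.add_apply, TensorProduct.map_tmul,
      verma_of, vermaGen_E, vermaGen_K, vermaGen_Kinv, TensorProduct.smul_tmul_smul, smul_add,
      smul_smul, mul_assoc]
    ring_nf
  rw [hwv_eq_sum, map_sum, Finset.sum_congr rfl h1, Finset.sum_add_distrib,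
    Finset.sum_range_succ', Finset.sum_range_succ]
  simp only [Nat.cast_zero, qnum_zero, zero_mul, mul_zero, zero_smul, add_zero, Nat.sub_self]
  rw [← Finset.sum_add_distrib]
  refine Finset.sum_eq_zero fun i hi => ?_
  obtain ⟨j, rfl⟩ := Nat.exists_eq_add_of_lt (Finset.mem_range.mp hi)
  have h2 : i + j + 1 - i - 1 = j := by omega
  have h3 : i + j + 1 - (i + 1) = j := by omega
  have h4 : i + j + 1 - i = j + 1 := by omega
  rw [h2, h3, h4, Nat.add_sub_cancel, ← add_smul]
  convert zero_smul ℂ _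
  rw [← hwvCoeff_succ hq g₁ g₂ i j]
  push_cast
  ring_nf

theorem tensorRep_K_hwv (h l₁ l₂ : ℂ) (n : ℕ) :
    tensorRep h l₁ l₂ (Uq.of h .K) (hwv h l₁ l₂ n) = qpow h (l₁ + l₂ - n) • hwv h l₁ l₂ n := by
  rw [hwv_eq_sum, map_sum, Finset.smul_sum]
  refine Finset.sum_congr rfl fun i hi => ?_
  obtain ⟨j, rfl⟩ := Nat.exists_eq_add_of_le (Nat.lt_succ_iff.mp (Finset.mem_range.mp hi))
  simp only [map_smul, tensorRep_eq_tens, tens_K, TensorProduct.map_tmul, verma_of, vermaGen_K,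
    TensorProduct.smul_tmul_smul, smul_smul, ← qpow_add, Nat.add_sub_cancel_left]
  rw [mul_comm]
  congr 3
  push_cast; ring

theorem psi_zero (h l₁ l₂ : ℂ) (n : ℕ) : psi h l₁ l₂ n (e 0) = hwv h l₁ l₂ n := by
  simp [psi]

theorem psi_succ (h l₁ l₂ : ℂ) (n m : ℕ) : psi h l₁ l₂ n (e (m + 1)) =
    tensorRep h l₁ l₂ (Uq.of h .F) (psi h l₁ l₂ n (e m)) := by
  simp [psi, pow_succ']

theorem psi_F (h l l₁ l₂ : ℂ) (n : ℕ) (x : V) : psi h l₁ l₂ n (vermaGen h l .F x) =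
    tensorRep h l₁ l₂ (Uq.of h .F) (psi h l₁ l₂ n x) := by
  suffices psi h l₁ l₂ n ∘ₗ vermaGen h l .F =
      tensorRep h l₁ l₂ (Uq.of h .F) ∘ₗ psi h l₁ l₂ n from LinearMap.congr_fun this x
  refine Finsupp.lhom_ext' fun m => LinearMap.ext_ring ?_
  simp only [LinearMap.comp_apply, Finsupp.lsingle_apply, vermaGen_F, psi_succ]

theorem module_add_right_cancel {M : Type*} [AddCommMonoid M] [Module ℂ M] {x y z : M}
    (hxy : x + z = y + z) : x = y :=
  letI := Module.addCommMonoidToAddCommGroup ℂ (M := M)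
  add_right_cancel hxy

/-- Compatibility with `F` is built into `psi`. For `K` it propagates from the weight of `hwv`, and
for `E` from `E hwv = 0`, by induction along the `F`-string with the commutation relations. -/
theorem intertwines_psi {h l₁ l₂ : ℂ} (hq : NotRootOfUnity h) (g₁ : Generic h l₁)
    (g₂ : Generic h l₂) (n : ℕ) :
    Intertwines (verma h (l₁ + l₂ - n)) (tensorRep h l₁ l₂) (psi h l₁ l₂ n) := by
  have hF : ∀ x, psi h l₁ l₂ n (verma h (l₁ + l₂ - n) (Uq.of h .F) x) =
      tensorRep h l₁ l₂ (Uq.of h .F) (psi h l₁ l₂ n x) := fun x => by rw [verma_of, psi_F]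
  have he : ∀ m, e (m + 1) = verma h (l₁ + l₂ - n) (Uq.of h .F) (e m) := fun m => by
    rw [verma_of, vermaGen_F]
  have hK : ∀ m, psi h l₁ l₂ n (verma h (l₁ + l₂ - n) (Uq.of h .K) (e m)) =
      tensorRep h l₁ l₂ (Uq.of h .K) (psi h l₁ l₂ n (e m)) := fun m => by
    induction m with
    | zero =>
      rw [verma_of, vermaGen_K, map_smul, psi_zero, tensorRep_K_hwv, Nat.cast_zero, sub_zero]
    | succ m ih => rw [he, rep_K_F, map_smul, hF, hF, rep_K_F, ih]
  have hKi : ∀ m, psi h l₁ l₂ n (verma h (l₁ + l₂ - n) (Uq.of h .Kinv) (e m)) =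
      tensorRep h l₁ l₂ (Uq.of h .Kinv) (psi h l₁ l₂ n (e m)) := fun m => by
    have h1 : e m = qpow h (-(l₁ + l₂ - n - m)) •
        verma h (l₁ + l₂ - n) (Uq.of h .K) (e m) := by
      rw [verma_of, vermaGen_K, smul_smul, mul_comm, qpow_mul_neg, one_smul]
    rw [h1]
    simp only [map_smul, rep_Kinv_K, hK]
  have hE : ∀ m, psi h l₁ l₂ n (verma h (l₁ + l₂ - n) (Uq.of h .E) (e m)) =
      tensorRep h l₁ l₂ (Uq.of h .E) (psi h l₁ l₂ n (e m)) := fun m => by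
    induction m with
    | zero =>
      simp [verma_of, vermaGen_E, psi_zero, tensorRep_E_hwv hq g₁ g₂, qnum_zero]
    | succ m ih =>
      have hK2 : ∀ m, psi h l₁ l₂ n (verma h (l₁ + l₂ - n) (Uq.of h .K)
          (verma h (l₁ + l₂ - n) (Uq.of h .K) (e m))) =
          tensorRep h l₁ l₂ (Uq.of h .K)
            (tensorRep h l₁ l₂ (Uq.of h .K) (psi h l₁ l₂ n (e m))) := fun m => by
        rw [← hK, verma_of, vermaGen_K]
        simp only [map_smul, ← hK, verma_of]
      have hKi2 : ∀ m, psi h l₁ l₂ n (verma h (l₁ + l₂ - n) (Uq.of h .Kinv)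
          (verma h (l₁ + l₂ - n) (Uq.of h .Kinv) (e m))) =
          tensorRep h l₁ l₂ (Uq.of h .Kinv)
            (tensorRep h l₁ l₂ (Uq.of h .Kinv) (psi h l₁ l₂ n (e m))) := fun m => by
        rw [← hKi, verma_of, vermaGen_Kinv]
        simp only [map_smul, ← hKi, verma_of]
      have h1 := congrArg (psi h l₁ l₂ n) (rep_E_F (verma h (l₁ + l₂ - n)) (e m))
      have h2 := rep_E_F (tensorRep h l₁ l₂) (psi h l₁ l₂ n (e m))
      simp only [map_add, map_smul, hK2, hKi2, hF, ih] at h1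
      rw [← h2] at h1
      rw [he, hF]
      exact module_add_right_cancel h1
  intro g
  refine Finsupp.lhom_ext' fun m => LinearMap.ext_ring ?_
  cases g
  · exact hE m
  · exact hF _
  · exact hK m
  · exact hKi m

/-! ### Contravariant forms -/

/-- The anti-involution of `U_q(sl₂)` on the generators. -/
def Gen.adj : Gen → Gen
  | .E => .F
  | .F => .E
  | .K => .K
  | .Kinv => .Kinv

section Contravariant

variable {h : ℂ} {M M' N N' : Type*} [AddCommMonoid M] [Module ℂ M] [AddCommMonoid N] [Module ℂ N]
  [AddCommMonoid M'] [Module ℂ M'] [AddCommMonoid N'] [Module ℂ N']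

/-- A bilinear form for which `E` and `F` are adjoint, and `K` is self-adjoint. -/
def Contravariant (ρ : Uq h →ₐ[ℂ] Module.End ℂ M) (B : LinearMap.BilinForm ℂ M) : Prop :=
  ∀ g : Gen, B ∘ₗ ρ (Uq.of h g) = B.compl₂ (ρ (Uq.of h g.adj))

variable {ρ : Uq h →ₐ[ℂ] Module.End ℂ M} {σ : Uq h →ₐ[ℂ] Module.End ℂ N}

theorem Contravariant.apply {B : LinearMap.BilinForm ℂ M} (hB : Contravariant ρ B) (g : Gen)
    (x y : M) : B (ρ (Uq.of h g) x) y = B x (ρ (Uq.of h g.adj) y) :=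
  LinearMap.congr_fun₂ (hB g) x y

/-- The coproducts of `E` and `F` have the same shape and `K` is self-adjoint, so the adjunction
passes to tensor products factor by factor. -/
theorem Contravariant.tmul {B : LinearMap.BilinForm ℂ M} {C : LinearMap.BilinForm ℂ N}
    (hB : Contravariant ρ B) (hC : Contravariant σ C) :
    Contravariant (tens ρ σ) (LinearMap.BilinForm.tmul B C) := by
  rintro (_ | _ | _ | _) <;> ext x y x' y' <;>
    simp [tens_E, tens_F, tens_K, tens_Kinv, Gen.adj, hB.apply, hC.apply]

theorem tmul_lTensor {B : LinearMap.BilinForm ℂ M} {C : LinearMap.BilinForm ℂ N}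
    {C' : LinearMap.BilinForm ℂ N'} {f g : N' →ₗ[ℂ] N} {c : ℂ}
    (hfg : ∀ x y, C (f x) (g y) = c * C' x y) (v w : M ⊗[ℂ] N') :
    LinearMap.BilinForm.tmul B C (f.lTensor M v) (g.lTensor M w) =
      c * LinearMap.BilinForm.tmul B C' v w := by
  suffices (LinearMap.BilinForm.tmul B C).compl₁₂ (f.lTensor M) (g.lTensor M) =
      c • LinearMap.BilinForm.tmul B C' from LinearMap.congr_fun₂ this v w
  ext x y x' y'
  simp [hfg, mul_assoc]

theorem tmul_rTensor {B : LinearMap.BilinForm ℂ M} {C : LinearMap.BilinForm ℂ N}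
    {B' : LinearMap.BilinForm ℂ M'} {f g : M' →ₗ[ℂ] M} {c : ℂ}
    (hfg : ∀ x y, B (f x) (g y) = c * B' x y) (v w : M' ⊗[ℂ] N) :
    LinearMap.BilinForm.tmul B C (f.rTensor N v) (g.rTensor N w) =
      c * LinearMap.BilinForm.tmul B' C v w := by
  suffices (LinearMap.BilinForm.tmul B C).compl₁₂ (f.rTensor N) (g.rTensor N) =
      c • LinearMap.BilinForm.tmul B' C from LinearMap.congr_fun₂ this v w
  ext x y x' y'
  simp [hfg, mul_left_comm]

theorem tmul_assoc (B : LinearMap.BilinForm ℂ M) (C : LinearMap.BilinForm ℂ N)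
    (D : LinearMap.BilinForm ℂ M') (v w : (M ⊗[ℂ] N) ⊗[ℂ] M') :
    LinearMap.BilinForm.tmul B (LinearMap.BilinForm.tmul C D)
      (TensorProduct.assoc ℂ M N M' v) (TensorProduct.assoc ℂ M N M' w) =
    LinearMap.BilinForm.tmul (LinearMap.BilinForm.tmul B C) D v w := by
  suffices (LinearMap.BilinForm.tmul B (LinearMap.BilinForm.tmul C D)).compl₁₂
      (TensorProduct.assoc ℂ M N M').toLinearMap (TensorProduct.assoc ℂ M N M').toLinearMap =
      LinearMap.BilinForm.tmul (LinearMap.BilinForm.tmul B C) D from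
    LinearMap.congr_fun₂ this v w
  ext x y z x' y' z'
  simp [mul_assoc]

end Contravariant

/-- The contravariant form on `M_l`. -/
def form (h l : ℂ) : LinearMap.BilinForm ℂ V :=
  Finsupp.linearCombination ℂ fun m : ℕ => normSq h l m • Finsupp.lapply m

theorem form_e (h l : ℂ) (i j : ℕ) : form h l (e i) (e j) = if i = j then normSq h l i else 0 := by
  by_cases hij : i = j
  · simp [form, hij]
  · simp [form, hij]

theorem contravariant_form (h l : ℂ) : Contravariant (verma h l) (form h l) := by
  intro g
  refine Finsupp.lhom_ext' fun i => LinearMap.ext_ring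
    (Finsupp.lhom_ext' fun j => LinearMap.ext_ring ?_)
  simp only [LinearMap.comp_apply, Finsupp.lsingle_apply, LinearMap.compl₂_apply]
  cases g
  · rcases i with _ | i
    · simp [Gen.adj, verma_of, vermaGen_E, vermaGen_F, form_e, qnum_zero]
    · simp only [Gen.adj, verma_of, vermaGen_E, vermaGen_F, map_smul, LinearMap.smul_apply,
        form_e, Nat.add_sub_cancel, add_left_inj, normSq_succ, smul_eq_mul, mul_ite, mul_zero]
      push_cast; ring_nf
  · rcases j with _ | j
    · simp [Gen.adj, verma_of, vermaGen_E, vermaGen_F, form_e, qnum_zero]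
    · simp only [Gen.adj, verma_of, vermaGen_E, vermaGen_F, map_smul,
        form_e, Nat.add_sub_cancel, add_left_inj, normSq_succ, smul_eq_mul, mul_ite, mul_zero]
      by_cases hij : i = j
      · subst hij
        simp only [if_true]
        push_cast; ring_nf
      · simp [hij]
  · simp only [Gen.adj, verma_of, vermaGen_K, map_smul, LinearMap.smul_apply, form_e]
    by_cases hij : i = j <;> simp [hij]
  · simp only [Gen.adj, verma_of, vermaGen_Kinv, map_smul, LinearMap.smul_apply, form_e]
    by_cases hij : i = j <;> simp [hij]

/-- The contravariant form on `M_{l₁} ⊗ M_{l₂}`. -/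
abbrev form₂ (h l₁ l₂ : ℂ) : LinearMap.BilinForm ℂ (V ⊗[ℂ] V) :=
  LinearMap.BilinForm.tmul (form h l₁) (form h l₂)

/-- The contravariant form on `M_{l₁} ⊗ (M_{l₂} ⊗ M_{l₃})`. -/
abbrev form₃ (h l₁ l₂ l₃ : ℂ) : LinearMap.BilinForm ℂ (V ⊗[ℂ] (V ⊗[ℂ] V)) :=
  LinearMap.BilinForm.tmul (form h l₁) (form₂ h l₂ l₃)

theorem form₂_hwv_self {h l₁ l₂ : ℂ} (hq : NotRootOfUnity h) (g₁ : Generic h l₁)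
    (g₂ : Generic h l₂) (g : Generic h (l₁ + l₂)) (n : ℕ) :
    form₂ h l₁ l₂ (hwv h l₁ l₂ n) (hwv h l₁ l₂ n) = 1 := by
  rw [← sum_hwvCoeff_sq hq g₁ g₂ g n, hwv_eq_sum]
  simp only [map_sum, LinearMap.sum_apply, map_smul, LinearMap.smul_apply,
    LinearMap.BilinForm.tensorDistrib_tmul, form_e, smul_eq_mul]
  refine Finset.sum_congr rfl fun i hi => ?_
  rw [Finset.sum_eq_single_of_mem i hi]
  · simp; ring
  · intro j _ hj
    simp [hj]

theorem form₂_hwv_of_ne (h l₁ l₂ : ℂ) {n m : ℕ} (hnm : n ≠ m) :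
    form₂ h l₁ l₂ (hwv h l₁ l₂ n) (hwv h l₁ l₂ m) = 0 := by
  rw [hwv_eq_sum, hwv_eq_sum]
  simp only [map_sum, LinearMap.sum_apply, map_smul, LinearMap.smul_apply,
    LinearMap.BilinForm.tensorDistrib_tmul, form_e, smul_eq_mul]
  refine Finset.sum_eq_zero fun j hj => mul_eq_zero_of_right _ (Finset.sum_eq_zero fun i hi => ?_)
  rw [Finset.mem_range] at hi hj
  by_cases hij : i = j
  · rw [if_neg (show ¬ n - i = m - j by omega), zero_mul, mul_zero]
  · simp [hij]

/-- The embeddings are isometries with mutually orthogonal images. Contravariance moves each `F` to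
an `E` on the other side, which reduces everything to the pairing of highest weight vectors. -/
theorem form₂_psi {h l₁ l₂ : ℂ} (hq : NotRootOfUnity h) (g₁ : Generic h l₁)
    (g₂ : Generic h l₂) (g : Generic h (l₁ + l₂)) (n m : ℕ) (x y : V) :
    form₂ h l₁ l₂ (psi h l₁ l₂ n x) (psi h l₁ l₂ m y) =
      (if n = m then 1 else 0) * form h (l₁ + l₂ - m) x y := by
  have hc : Contravariant (tensorRep h l₁ l₂) (form₂ h l₁ l₂) :=
    (contravariant_form h l₁).tmul (contravariant_form h l₂)
  have h0 : form₂ h l₁ l₂ (hwv h l₁ l₂ n) (hwv h l₁ l₂ m) = if n = m then 1 else 0 := by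
    split_ifs with hnm
    · rw [hnm, form₂_hwv_self hq g₁ g₂ g]
    · exact form₂_hwv_of_ne h l₁ l₂ hnm
  suffices (form₂ h l₁ l₂).compl₁₂ (psi h l₁ l₂ n) (psi h l₁ l₂ m) =
      (if n = m then (1 : ℂ) else 0) • form h (l₁ + l₂ - m) from LinearMap.congr_fun₂ this x y
  refine Finsupp.lhom_ext' fun i => LinearMap.ext_ring
    (Finsupp.lhom_ext' fun j => LinearMap.ext_ring ?_)
  simp only [LinearMap.comp_apply, Finsupp.lsingle_apply, LinearMap.compl₁₂_apply,
    LinearMap.smul_apply, smul_eq_mul, form_e]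
  induction i generalizing j with
  | zero =>
    rcases j with _ | j
    · rw [psi_zero, psi_zero, h0]; simp [normSq_zero]
    · have h1 := hc.apply .E (psi h l₁ l₂ n (e 0)) (psi h l₁ l₂ m (e j))
      rw [psi_zero, tensorRep_E_hwv hq g₁ g₂] at h1
      rw [psi_succ, psi_zero]
      refine h1.symm.trans ?_
      simp
  | succ i ih =>
    have h1 := (hc.apply .F (psi h l₁ l₂ n (e i)) (psi h l₁ l₂ m (e j))).trans
      (congrArg _ ((intertwines_psi hq g₁ g₂ m).apply .E (e j)).symm)
    rw [psi_succ, h1, verma_of, vermaGen_E, map_smul, map_smul, ih]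
    rcases j with _ | j
    · simp [qnum_zero]
    · by_cases hij : i = j
      · subst hij
        simp only [Nat.add_sub_cancel, if_true, normSq_succ, smul_eq_mul]
        push_cast; ring_nf
      · simp [hij]

theorem form₃_rightEmb {h l₁ l₂ l₃ : ℂ} (hq : NotRootOfUnity h) (g₁ : Generic h l₁)
    (g₂ : Generic h l₂) (g₃ : Generic h l₃) (g₂₃ : Generic h (l₂ + l₃))
    (g : Generic h (l₁ + l₂ + l₃)) (N : ℕ) (n m : Fin (N + 1)) :
    form₃ h l₁ l₂ l₃ (rightEmb h l₁ l₂ l₃ N n (e 0)) (rightEmb h l₁ l₂ l₃ N m (e 0)) =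
      if n = m then 1 else 0 := by
  simp only [rightEmb, LinearMap.comp_apply, psi_zero]
  rw [tmul_lTensor (form₂_psi hq g₂ g₃ g₂₃ n m)]
  split_ifs with h1 h2 h2
  · subst h2
    have g' : Generic h (l₁ + (l₂ + l₃ - (n : ℕ))) := by
      have := g.sub_nat n
      rwa [add_assoc, add_sub_assoc] at this
    rw [one_mul]
    exact form₂_hwv_self hq g₁ (g₂₃.sub_nat n) g' _
  · exact absurd (Fin.ext h1) h2
  · exact absurd (congrArg _ h2) h1
  · rw [zero_mul]

theorem form₃_leftEmb {h l₁ l₂ l₃ : ℂ} (hq : NotRootOfUnity h) (g₁ : Generic h l₁)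
    (g₂ : Generic h l₂) (g₃ : Generic h l₃) (g₁₂ : Generic h (l₁ + l₂))
    (g : Generic h (l₁ + l₂ + l₃)) (N : ℕ) (n m : Fin (N + 1)) :
    form₃ h l₁ l₂ l₃ (leftEmb h l₁ l₂ l₃ N n (e 0)) (leftEmb h l₁ l₂ l₃ N m (e 0)) =
      if n = m then 1 else 0 := by
  simp only [leftEmb, LinearMap.comp_apply, psi_zero, LinearEquiv.coe_coe]
  rw [tmul_assoc, tmul_rTensor (form₂_psi hq g₁ g₂ g₁₂ n m)]
  split_ifs with h1 h2 h2
  · subst h2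
    have g' : Generic h (l₁ + l₂ - (n : ℕ) + l₃) := by
      have := g.sub_nat n
      rwa [add_sub_right_comm] at this
    rw [one_mul]
    exact form₂_hwv_self hq (g₁₂.sub_nat n) g₃ g' _
  · exact absurd (Fin.ext h1) h2
  · exact absurd (congrArg _ h2) h1
  · rw [zero_mul]

/-! ### Extremal components of the embeddings -/

theorem lastCoord_hwv (h l₁ l₂ : ℂ) (n : ℕ) :
    lastCoord V 0 (hwv h l₁ l₂ n) = hwvCoeff h l₁ l₂ n n • e n := by
  rw [hwv_eq_sum, map_sum, Finset.sum_eq_single_of_mem n (Finset.self_mem_range_succ n)]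
  · simp
  · intro i hi hin
    rw [Finset.mem_range] at hi
    rw [map_smul, lastCoord_tmul, Finsupp.single_eq_of_ne (by omega), zero_smul, smul_zero]

theorem firstCoord_hwv (h l₁ l₂ : ℂ) (n : ℕ) :
    firstCoord V (hwv h l₁ l₂ n) = hwvCoeff h l₁ l₂ n 0 • e n := by
  rw [hwv_eq_sum, map_sum, Finset.sum_eq_single_of_mem 0 (by simp)]
  · simp
  · intro i hi hin
    rw [map_smul, firstCoord_tmul, Finsupp.single_eq_of_ne (Ne.symm hin), zero_smul, smul_zero]

theorem lastCoord_psi (h l₁ l₂ : ℂ) (n k : ℕ) :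
    lastCoord V 0 (psi h l₁ l₂ n (e k)) =
      (hwvCoeff h l₁ l₂ n n * qpow h (k * l₂)) • e (n + k) := by
  induction k with
  | zero => rw [psi_zero, lastCoord_hwv]; simp [qpow_zero]
  | succ k ih =>
    have h1 := LinearMap.congr_fun (lastCoord_comp_F (ρ := verma h l₁) l₂)
      (psi h l₁ l₂ n (e k))
    rw [psi_succ]
    refine h1.trans ?_
    rw [LinearMap.smul_apply, LinearMap.comp_apply, ih, map_smul, verma_of, vermaGen_F, smul_smul,
      mul_left_comm, ← qpow_add, add_assoc]
    push_cast; ring_nf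

theorem firstCoord_psi (h l₁ l₂ : ℂ) (n k : ℕ) :
    firstCoord V (psi h l₁ l₂ n (e k)) =
      (hwvCoeff h l₁ l₂ n 0 * qpow h (-(k * l₁))) • e (n + k) := by
  induction k with
  | zero => rw [psi_zero, firstCoord_hwv]; simp [qpow_zero]
  | succ k ih =>
    have h1 := LinearMap.congr_fun (firstCoord_comp_F (ρ := verma h l₂) l₁)
      (psi h l₁ l₂ n (e k))
    rw [psi_succ]
    refine h1.trans ?_
    rw [LinearMap.smul_apply, LinearMap.comp_apply, ih, map_smul, verma_of, vermaGen_F, smul_smul,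
      mul_left_comm, ← qpow_add, add_assoc]
    push_cast; ring_nf

/-! ### Highest weight components of triple tensor products -/

theorem lTensor_lastCoord_assoc (x : (V ⊗[ℂ] V) ⊗[ℂ] V) :
    (lastCoord V 0).lTensor V (TensorProduct.assoc ℂ V V V x) = lastCoord (V ⊗[ℂ] V) 0 x := by
  suffices (lastCoord V 0).lTensor V ∘ₗ (TensorProduct.assoc ℂ V V V).toLinearMap =
    lastCoord (V ⊗[ℂ] V) 0 from LinearMap.congr_fun this x
  refine TensorProduct.ext_threefold fun a b c => ?_
  simp

theorem lTensor_firstCoord_assoc (x : (V ⊗[ℂ] V) ⊗[ℂ] V) :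
    (firstCoord V).lTensor V (TensorProduct.assoc ℂ V V V x) = (lastCoord V 0).rTensor V x := by
  suffices (firstCoord V).lTensor V ∘ₗ (TensorProduct.assoc ℂ V V V).toLinearMap =
    (lastCoord V 0).rTensor V from LinearMap.congr_fun this x
  refine TensorProduct.ext_threefold fun a b c => ?_
  simp [TensorProduct.smul_tmul]

theorem firstCoord_assoc (x : (V ⊗[ℂ] V) ⊗[ℂ] V) :
    firstCoord (V ⊗[ℂ] V) (TensorProduct.assoc ℂ V V V x) = (firstCoord V).rTensor V x := by
  suffices firstCoord (V ⊗[ℂ] V) ∘ₗ (TensorProduct.assoc ℂ V V V).toLinearMap =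
    (firstCoord V).rTensor V from LinearMap.congr_fun this x
  refine TensorProduct.ext_threefold fun a b c => ?_
  simp [TensorProduct.smul_tmul']

theorem lastCoord_rTensor {M N : Type*} [AddCommMonoid M] [Module ℂ M] [AddCommMonoid N]
    [Module ℂ N] (f : M →ₗ[ℂ] N) (x : M ⊗[ℂ] V) :
    lastCoord N 0 (f.rTensor V x) = f (lastCoord M 0 x) := by
  suffices lastCoord N 0 ∘ₗ f.rTensor V = f ∘ₗ lastCoord M 0 from LinearMap.congr_fun this x
  refine TensorProduct.ext' fun a b => ?_
  simp

theorem firstCoord_lTensor {M N : Type*} [AddCommMonoid M] [Module ℂ M] [AddCommMonoid N]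
    [Module ℂ N] (f : M →ₗ[ℂ] N) (x : V ⊗[ℂ] M) :
    firstCoord N (f.lTensor V x) = f (firstCoord M x) := by
  suffices firstCoord N ∘ₗ f.lTensor V = f ∘ₗ firstCoord M from LinearMap.congr_fun this x
  refine TensorProduct.ext' fun a b => ?_
  simp

theorem leftEmb_zero (h l₁ l₂ l₃ : ℂ) (N : ℕ) (j : Fin (N + 1)) :
    leftEmb h l₁ l₂ l₃ N j (e 0) = TensorProduct.assoc ℂ V V V
      ((psi h l₁ l₂ j).rTensor V (hwv h (l₁ + l₂ - (j : ℕ)) l₃ (N - j))) := by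
  rw [← psi_zero]; rfl

theorem rightEmb_zero (h l₁ l₂ l₃ : ℂ) (N : ℕ) (j : Fin (N + 1)) :
    rightEmb h l₁ l₂ l₃ N j (e 0) =
      (psi h l₂ l₃ j).lTensor V (hwv h l₁ (l₂ + l₃ - (j : ℕ)) (N - j)) := by
  rw [← psi_zero]; rfl

theorem lTensor_lastCoord_leftEmb (h l₁ l₂ l₃ : ℂ) (N : ℕ) (j : Fin (N + 1)) :
    (lastCoord V 0).lTensor V (leftEmb h l₁ l₂ l₃ N j (e 0)) =
      hwvCoeff h (l₁ + l₂ - (j : ℕ)) l₃ (N - j) (N - j) • psi h l₁ l₂ j (e (N - j)) := by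
  rw [leftEmb_zero, lTensor_lastCoord_assoc, lastCoord_rTensor, lastCoord_hwv, map_smul]

theorem firstCoord_rightEmb (h l₁ l₂ l₃ : ℂ) (N : ℕ) (j : Fin (N + 1)) :
    firstCoord (V ⊗[ℂ] V) (rightEmb h l₁ l₂ l₃ N j (e 0)) =
      hwvCoeff h l₁ (l₂ + l₃ - (j : ℕ)) (N - j) 0 • psi h l₂ l₃ j (e (N - j)) := by
  rw [rightEmb_zero, firstCoord_lTensor, firstCoord_hwv, map_smul]

/-- The naturality of the braiding of `M_{l₃}` with `M_{l₁} ⊗ M_{l₂}`. -/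
theorem lTensor_lastCoord_leftEmb_eq_smul (h l₁ l₂ l₃ : ℂ) (N : ℕ) (j : Fin (N + 1)) :
    (lastCoord V 0).lTensor V (leftEmb h l₁ l₂ l₃ N j (e 0)) =
      hwvRatio h (l₁ + l₂ - (j : ℕ)) l₃ (N - j) •
        firstCoord (V ⊗[ℂ] V) (rightEmb h l₃ l₁ l₂ N j (e 0)) := by
  rw [lTensor_lastCoord_leftEmb, firstCoord_rightEmb, hwvCoeff_self, smul_smul]

/-- The operator `e m ↦ q ^ (-2 l m) e m`. -/
def twist (h l : ℂ) : V →ₗ[ℂ] V :=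
  Finsupp.linearCombination ℂ fun m : ℕ => qpow h (-(2 * l * m)) • e m

theorem twist_e (h l : ℂ) (m : ℕ) : twist h l (e m) = qpow h (-(2 * l * m)) • e m := by
  rw [twist, Finsupp.linearCombination_single, one_smul]

/-- Applying `F` `k` times scales the two `e 0`-components by `q ^ (k l₃)` and `q ^ (-k l₃)`. Both
are multiples of `e (n + k)`, on which `twist` supplies the discrepancy `q ^ (-2 k l₃)`. -/
theorem twist_lastCoord_psi (h l₁ l₃ : ℂ) (n : ℕ) :
    twist h l₃ ∘ₗ lastCoord V 0 ∘ₗ psi h l₁ l₃ n =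
      (qpow h (-(2 * l₃ * n)) * hwvRatio h l₁ l₃ n) • (firstCoord V ∘ₗ psi h l₃ l₁ n) := by
  refine Finsupp.lhom_ext' fun k => LinearMap.ext_ring ?_
  have hx : qpow h (k * l₃) * qpow h (-(2 * l₃ * (n + k : ℕ))) =
      qpow h (-(2 * l₃ * n)) * qpow h (-(k * l₃)) := by
    rw [← qpow_add, ← qpow_add]; congr 1; push_cast; ring
  simp only [LinearMap.comp_apply, Finsupp.lsingle_apply, LinearMap.smul_apply, lastCoord_psi,
    firstCoord_psi, map_smul, twist_e, smul_smul, hwvCoeff_self h l₁]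
  rw [mul_assoc, hx]
  ring_nf

theorem twist_leftEmb (h l₁ l₂ l₃ : ℂ) (N : ℕ) (n : Fin (N + 1)) :
    (twist h l₃).rTensor V ((firstCoord V).lTensor V (leftEmb h l₁ l₃ l₂ N n (e 0))) =
      (qpow h (-(2 * l₃ * (n : ℕ))) * hwvRatio h l₁ l₃ n) •
        firstCoord (V ⊗[ℂ] V) (leftEmb h l₃ l₁ l₂ N n (e 0)) := by
  rw [leftEmb_zero, leftEmb_zero, lTensor_firstCoord_assoc, firstCoord_assoc,
    ← LinearMap.rTensor_comp_apply, ← LinearMap.rTensor_comp_apply, ← LinearMap.rTensor_comp_apply,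
    LinearMap.comp_assoc, twist_lastCoord_psi, LinearMap.rTensor_smul, LinearMap.smul_apply, add_comm l₃ l₁]

/-- Here `twist` acts on `M_{l₁}`, which is not the factor that `M_{l₃}` crosses. In a term `e i ⊗ ψ
(e j)` the weight constraint `i + j = N - n` trades its factor `q ^ (-2 l₃ i)` for `q ^ (2 l₃ j)`
times a constant, which is the correction needed for `M_{l₂}`. -/
theorem twist_rightEmb (h l₁ l₂ l₃ : ℂ) (N : ℕ) (n : Fin (N + 1)) :
    (twist h l₃).rTensor V ((firstCoord V).lTensor V (rightEmb h l₁ l₃ l₂ N n (e 0))) =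
      (qpow h (-(2 * l₃ * (N - n : ℕ))) * (hwvRatio h l₂ l₃ n)⁻¹) •
        (lastCoord V 0).lTensor V (rightEmb h l₁ l₂ l₃ N n (e 0)) := by
  rw [rightEmb_zero, rightEmb_zero, add_comm l₃ l₂, ← LinearMap.lTensor_comp_apply,
    ← LinearMap.lTensor_comp_apply, hwv_eq_sum]
  simp only [map_sum, Finset.smul_sum]
  refine Finset.sum_congr rfl fun i hi => ?_
  obtain ⟨j, hj⟩ := Nat.exists_eq_add_of_le (Nat.lt_succ_iff.mp (Finset.mem_range.mp hi))
  have hr := hwvRatio_ne_zero h l₂ l₃ n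
  have hx : qpow h (-(2 * l₃ * (i + j : ℕ))) * qpow h (j * l₃) =
      qpow h (-(2 * l₃ * i)) * qpow h (-(j * l₃)) := by
    rw [← qpow_add, ← qpow_add]; congr 1; push_cast; ring
  rw [hj, Nat.add_sub_cancel_left]
  simp only [map_smul, LinearMap.lTensor_tmul, LinearMap.rTensor_tmul, LinearMap.comp_apply,
    lastCoord_psi, firstCoord_psi, twist_e, TensorProduct.tmul_smul, TensorProduct.smul_tmul',
    smul_smul, hwvCoeff_self h l₂]
  congr 2
  calc _ = hwvCoeff h l₃ l₂ n 0 * hwvCoeff h l₁ (l₂ + l₃ - (n : ℕ)) (i + j) i *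
        (qpow h (-(2 * l₃ * i)) * qpow h (-(j * l₃))) := by ring
    _ = hwvCoeff h l₃ l₂ n 0 * hwvCoeff h l₁ (l₂ + l₃ - (n : ℕ)) (i + j) i *
        (qpow h (-(2 * l₃ * (i + j : ℕ))) * qpow h (j * l₃)) *
        ((hwvRatio h l₂ l₃ n)⁻¹ * hwvRatio h l₂ l₃ n) := by
      rw [inv_mul_cancel₀ hr, mul_one, hx]
    _ = _ := by ring

/-! ### The weight spaces -/

/-- The weight space of `M_{l₁} ⊗ M_{l₂}` spanned by the vectors `e i ⊗ e j`, `i + j = N`. -/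
def wtSpace (N : ℕ) : Submodule ℂ (V ⊗[ℂ] V) :=
  Submodule.span ℂ (Set.range fun i : Fin (N + 1) => e (i : ℕ) ⊗ₜ[ℂ] e (N - i))

theorem tmul_mem_wtSpace (i j : ℕ) : e i ⊗ₜ[ℂ] e j ∈ wtSpace (i + j) :=
  Submodule.subset_span ⟨⟨i, by omega⟩, by simp⟩

theorem hwv_mem_wtSpace (h l₁ l₂ : ℂ) (n : ℕ) : hwv h l₁ l₂ n ∈ wtSpace n := by
  rw [hwv_eq_sum]
  refine Submodule.sum_mem _ fun i hi => Submodule.smul_mem _ _ ?_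
  obtain ⟨j, rfl⟩ := Nat.exists_eq_add_of_le (Nat.lt_succ_iff.mp (Finset.mem_range.mp hi))
  rw [Nat.add_sub_cancel_left]
  exact tmul_mem_wtSpace i j

theorem tensorRep_F_mem_wtSpace (h l₁ l₂ : ℂ) {n : ℕ} {x : V ⊗[ℂ] V} (hx : x ∈ wtSpace n) :
    tensorRep h l₁ l₂ (Uq.of h .F) x ∈ wtSpace (n + 1) := by
  induction hx using Submodule.span_induction with
  | zero => rw [map_zero]; exact Submodule.zero_mem _
  | add x y _ _ hx hy => rw [map_add]; exact Submodule.add_mem _ hx hy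
  | smul c x _ hx => rw [map_smul]; exact Submodule.smul_mem _ _ hx
  | mem x hx =>
    obtain ⟨⟨i, hi⟩, rfl⟩ := hx
    obtain ⟨j, rfl⟩ := Nat.exists_eq_add_of_le (Nat.lt_succ_iff.mp hi)
    simp only [tensorRep_eq_tens, tens_F, verma_of, LinearMap.add_apply, TensorProduct.map_tmul,
      vermaGen_F, vermaGen_K, vermaGen_Kinv, TensorProduct.tmul_smul, ← TensorProduct.smul_tmul',
      Nat.add_sub_cancel_left]
    refine Submodule.add_mem _ (Submodule.smul_mem _ _ ?_) (Submodule.smul_mem _ _ ?_)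
    · rw [add_right_comm]; exact tmul_mem_wtSpace (i + 1) j
    · exact tmul_mem_wtSpace i (j + 1)

theorem psi_mem_wtSpace (h l₁ l₂ : ℂ) (n k : ℕ) : psi h l₁ l₂ n (e k) ∈ wtSpace (n + k) := by
  induction k with
  | zero => rw [psi_zero]; exact hwv_mem_wtSpace h l₁ l₂ n
  | succ k ih => rw [psi_succ]; exact tensorRep_F_mem_wtSpace h l₁ l₂ ih

theorem lTensor_lastCoord_leftEmb_mem (h l₁ l₂ l₃ : ℂ) (N : ℕ) (j : Fin (N + 1)) :
    (lastCoord V 0).lTensor V (leftEmb h l₁ l₂ l₃ N j (e 0)) ∈ wtSpace N := by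
  rw [lTensor_lastCoord_leftEmb]
  have := psi_mem_wtSpace h l₁ l₂ j (N - j)
  rw [Nat.add_sub_cancel' (Nat.lt_succ_iff.mp j.2)] at this
  exact Submodule.smul_mem _ _ this

theorem lTensor_lastCoord_rightEmb_mem (h l₁ l₂ l₃ : ℂ) (N : ℕ) (n : Fin (N + 1)) :
    (lastCoord V 0).lTensor V (rightEmb h l₁ l₂ l₃ N n (e 0)) ∈ wtSpace N := by
  rw [rightEmb_zero, ← LinearMap.lTensor_comp_apply, hwv_eq_sum, map_sum]
  refine Submodule.sum_mem _ fun i hi => ?_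
  rw [map_smul, LinearMap.lTensor_tmul, LinearMap.comp_apply, lastCoord_psi,
    TensorProduct.tmul_smul]
  refine Submodule.smul_mem _ _ (Submodule.smul_mem _ _ ?_)
  have := tmul_mem_wtSpace i (n + (N - n - i))
  rw [Finset.mem_range] at hi
  rwa [show i + (n + (N - n - i)) = N by omega] at this

/-! ### Existence, uniqueness and orthogonality of the `q6j`-symbols -/

theorem rep₃_E_leftEmb {h l₁ l₂ l₃ : ℂ} (hq : NotRootOfUnity h) (g₁ : Generic h l₁)
    (g₂ : Generic h l₂) (g₃ : Generic h l₃) (g₁₂ : Generic h (l₁ + l₂)) (N : ℕ)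
    (j : Fin (N + 1)) :
    tens (verma h l₁) (tensorRep h l₂ l₃) (Uq.of h .E) (leftEmb h l₁ l₂ l₃ N j (e 0)) = 0 := by
  rw [leftEmb_zero]
  refine ((intertwines_assoc (ρ := verma h l₁) (σ := verma h l₂) (τ := verma h l₃)).apply .E
    _).symm.trans ?_
  have h1 := ((intertwines_psi hq g₁ g₂ j).rTensor (σ := verma h l₃)).apply .E
    (hwv h (l₁ + l₂ - (j : ℕ)) l₃ (N - j))
  rw [← tensorRep_eq_tens, tensorRep_E_hwv hq (g₁₂.sub_nat j) g₃, map_zero] at h1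
  rw [← tensorRep_eq_tens, ← h1, map_zero]

theorem rep₃_E_rightEmb {h l₁ l₂ l₃ : ℂ} (hq : NotRootOfUnity h) (g₁ : Generic h l₁)
    (g₂ : Generic h l₂) (g₃ : Generic h l₃) (g₂₃ : Generic h (l₂ + l₃)) (N : ℕ)
    (j : Fin (N + 1)) :
    tens (verma h l₁) (tensorRep h l₂ l₃) (Uq.of h .E) (rightEmb h l₁ l₂ l₃ N j (e 0)) = 0 := by
  rw [rightEmb_zero]
  have h1 := ((intertwines_psi hq g₂ g₃ j).lTensor (σ := verma h l₁)).apply .E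
    (hwv h l₁ (l₂ + l₃ - (j : ℕ)) (N - j))
  rw [← tensorRep_eq_tens, tensorRep_E_hwv hq g₁ (g₂₃.sub_nat j), map_zero] at h1
  exact h1.symm

theorem leftEmb_succ {h l₁ l₂ l₃ : ℂ} (hq : NotRootOfUnity h) (g₁ : Generic h l₁)
    (g₂ : Generic h l₂) (N : ℕ) (j : Fin (N + 1)) (m : ℕ) :
    leftEmb h l₁ l₂ l₃ N j (e (m + 1)) =
      tens (verma h l₁) (tensorRep h l₂ l₃) (Uq.of h .F) (leftEmb h l₁ l₂ l₃ N j (e m)) := by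
  refine Eq.trans ?_ ((intertwines_assoc (ρ := verma h l₁) (σ := verma h l₂)
    (τ := verma h l₃)).apply .F _)
  refine congrArg (TensorProduct.assoc ℂ V V V) ?_
  rw [LinearMap.comp_apply, psi_succ]
  exact ((intertwines_psi hq g₁ g₂ j).rTensor (σ := verma h l₃)).apply .F _

theorem rightEmb_succ {h l₁ l₂ l₃ : ℂ} (hq : NotRootOfUnity h) (g₂ : Generic h l₂)
    (g₃ : Generic h l₃) (N : ℕ) (j : Fin (N + 1)) (m : ℕ) :
    rightEmb h l₁ l₂ l₃ N j (e (m + 1)) =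
      tens (verma h l₁) (tensorRep h l₂ l₃) (Uq.of h .F) (rightEmb h l₁ l₂ l₃ N j (e m)) := by
  rw [rightEmb, LinearMap.comp_apply, psi_succ]
  exact ((intertwines_psi hq g₂ g₃ j).lTensor (σ := verma h l₁)).apply .F _

/-- Both families of embeddings commute with `F`, and `e 0` generates the Verma module under `F`. -/
theorem isExpansion_iff {h l₁ l₂ l₃ : ℂ} (hq : NotRootOfUnity h) (g₁ : Generic h l₁)
    (g₂ : Generic h l₂) (g₃ : Generic h l₃) (N : ℕ) (j : Fin (N + 1)) (c : Fin (N + 1) → ℂ) :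
    IsExpansion h l₁ l₂ l₃ N j c ↔ leftEmb h l₁ l₂ l₃ N j (e 0) =
      ∑ n, c n • rightEmb h l₁ l₂ l₃ N n (e 0) := by
  refine ⟨fun hc => ?_, fun hc => ?_⟩
  · simpa using LinearMap.congr_fun hc (e 0)
  · refine Finsupp.lhom_ext' fun m => LinearMap.ext_ring ?_
    simp only [LinearMap.comp_apply, Finsupp.lsingle_apply, LinearMap.sum_apply,
      LinearMap.smul_apply]
    induction m with
    | zero => exact hc
    | succ m ih =>
      simp only [leftEmb_succ hq g₁ g₂, rightEmb_succ hq g₂ g₃, ih, map_sum, map_smul]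

/-- A vector of `M_{l₁} ⊗ M_{l₂} ⊗ M_{l₃}` killed by `E` is determined by its component at the
highest weight vector of `M_{l₃}`. -/
theorem eq_zero_of_lTensor_lastCoord {h l₁ l₂ l₃ : ℂ} (hq : NotRootOfUnity h)
    (g₃ : Generic h l₃) {v : V ⊗[ℂ] (V ⊗[ℂ] V)}
    (hE : tens (verma h l₁) (tensorRep h l₂ l₃) (Uq.of h .E) v = 0)
    (h0 : (lastCoord V 0).lTensor V v = 0) : v = 0 := by
  obtain ⟨w, rfl⟩ := (TensorProduct.assoc ℂ V V V).surjective v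
  rw [lTensor_lastCoord_assoc] at h0
  have h1 := (intertwines_assoc (ρ := verma h l₁) (σ := verma h l₂) (τ := verma h l₃)).apply .E w
  rw [← tensorRep_eq_tens h l₂] at h1
  have h2 : tens (tens (verma h l₁) (verma h l₂)) (verma h l₃) (Uq.of h .E) w = 0 := by
    apply (TensorProduct.assoc ℂ V V V).injective
    rw [map_zero]
    exact h1.trans hE
  rw [eq_zero_of_E_eq_zero hq g₃ h2 h0, map_zero]

theorem eq_of_lTensor_lastCoord {h l₁ l₂ l₃ : ℂ} (hq : NotRootOfUnity h)
    (g₃ : Generic h l₃) {v w : V ⊗[ℂ] (V ⊗[ℂ] V)}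
    (hv : tens (verma h l₁) (tensorRep h l₂ l₃) (Uq.of h .E) v = 0)
    (hw : tens (verma h l₁) (tensorRep h l₂ l₃) (Uq.of h .E) w = 0)
    (h0 : (lastCoord V 0).lTensor V v = (lastCoord V 0).lTensor V w) : v = w := by
  -- Scalar multiplication by `-1` replaces subtraction in the additive monoids.
  have hneg : ∀ {M : Type} [AddCommMonoid M] [Module ℂ M] (x : M), x + (-1 : ℂ) • x = 0 := by
    intro M _ _ x
    conv_lhs => rw [← one_smul ℂ x, smul_smul, ← add_smul]
    norm_num
  apply module_add_right_cancel (z := (-1 : ℂ) • w)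
  rw [hneg]
  refine eq_zero_of_lTensor_lastCoord (l₁ := l₁) (l₂ := l₂) hq g₃ ?_ ?_
  · rw [map_add, map_smul, hv, hw, smul_zero, add_zero]
  · rw [map_add, map_smul, h0, hneg]

/-- Dimension count: `k` independent vectors inside the span of `k` vectors fill that span. -/
theorem exists_sum_eq_of_mem_span {M : Type*} [AddCommGroup M] [Module ℂ M] {k : ℕ}
    {w v : Fin k → M} (hv : ∀ n, v n ∈ Submodule.span ℂ (Set.range w))
    (hinj : ∀ c d : Fin k → ℂ, ∑ n, c n • v n = ∑ n, d n • v n → c = d) {x : M}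
    (hx : x ∈ Submodule.span ℂ (Set.range w)) : ∃ c : Fin k → ℂ, ∑ n, c n • v n = x := by
  have hli : LinearIndependent ℂ v := by
    rw [Fintype.linearIndependent_iff]
    intro c hc
    exact congrFun (hinj c 0 (by simpa using hc))
  have := FiniteDimensional.span_of_finite ℂ (Set.finite_range w)
  have hspan : Submodule.span ℂ (Set.range v) = Submodule.span ℂ (Set.range w) := by
    refine Submodule.eq_of_le_of_finrank_le ?_ ?_
    · rw [Submodule.span_le]
      rintro _ ⟨n, rfl⟩
      exact hv n
    · rw [finrank_span_eq_card hli]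
      exact finrank_range_le_card w
  rwa [← hspan, Submodule.mem_span_range_iff_exists_fun] at hx

section Orthogonality

variable {h l₁ l₂ l₃ : ℂ}

theorem form₃_sum_rightEmb (hq : NotRootOfUnity h) (g₁ : Generic h l₁) (g₂ : Generic h l₂)
    (g₃ : Generic h l₃) (g₂₃ : Generic h (l₂ + l₃)) (g : Generic h (l₁ + l₂ + l₃)) (N : ℕ)
    (c d : Fin (N + 1) → ℂ) :
    form₃ h l₁ l₂ l₃ (∑ n, c n • rightEmb h l₁ l₂ l₃ N n (e 0))
      (∑ n, d n • rightEmb h l₁ l₂ l₃ N n (e 0)) = ∑ n, c n * d n := by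
  simp only [map_sum, LinearMap.sum_apply, map_smul, LinearMap.smul_apply,
    form₃_rightEmb hq g₁ g₂ g₃ g₂₃ g, smul_eq_mul]
  simp [mul_comm]

/-- Equal components force equal vectors because all of them are killed by `E`; pairing with one
orthonormal vector then reads off each coefficient. -/
theorem sum_lTensor_lastCoord_rightEmb_injective (hq : NotRootOfUnity h) (g₁ : Generic h l₁)
    (g₂ : Generic h l₂) (g₃ : Generic h l₃) (g₂₃ : Generic h (l₂ + l₃))
    (g : Generic h (l₁ + l₂ + l₃)) (N : ℕ) (c d : Fin (N + 1) → ℂ)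
    (hcd : ∑ n, c n • (lastCoord V 0).lTensor V (rightEmb h l₁ l₂ l₃ N n (e 0)) =
      ∑ n, d n • (lastCoord V 0).lTensor V (rightEmb h l₁ l₂ l₃ N n (e 0))) : c = d := by
  have hE : ∀ c : Fin (N + 1) → ℂ, tens (verma h l₁) (tensorRep h l₂ l₃) (Uq.of h .E)
      (∑ n, c n • rightEmb h l₁ l₂ l₃ N n (e 0)) = 0 := fun c => by
    simp only [map_sum, map_smul, rep₃_E_rightEmb hq g₁ g₂ g₃ g₂₃, smul_zero,
      Finset.sum_const_zero]
  have h1 := eq_of_lTensor_lastCoord (l₁ := l₁) (l₂ := l₂) hq g₃ (hE c) (hE d)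
    (by simpa only [map_sum, map_smul] using hcd)
  funext n
  have h2 := form₃_sum_rightEmb hq g₁ g₂ g₃ g₂₃ g N c (Pi.single n 1)
  rw [h1, form₃_sum_rightEmb hq g₁ g₂ g₃ g₂₃ g] at h2
  simpa [Pi.single_apply] using h2.symm

/-- The components at `e 0` of the last factor all lie in `wtSpace N`, which has `N + 1` generators.
Those of the `N + 1` right embeddings are independent, hence span it. The relation among components
lifts to the vectors themselves, as these are killed by `E`. -/
theorem existsUnique_isExpansion (hq : NotRootOfUnity h) (g₁ : Generic h l₁) (g₂ : Generic h l₂)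
    (g₃ : Generic h l₃) (g₁₂ : Generic h (l₁ + l₂)) (g₂₃ : Generic h (l₂ + l₃))
    (g : Generic h (l₁ + l₂ + l₃)) (N : ℕ) (j : Fin (N + 1)) :
    ∃! c, IsExpansion h l₁ l₂ l₃ N j c := by
  have hinj := sum_lTensor_lastCoord_rightEmb_injective hq g₁ g₂ g₃ g₂₃ g N
  obtain ⟨c, hc⟩ := exists_sum_eq_of_mem_span
    (w := fun i : Fin (N + 1) => e (i : ℕ) ⊗ₜ[ℂ] e (N - i))
    (lTensor_lastCoord_rightEmb_mem h l₁ l₂ l₃ N) hinj (lTensor_lastCoord_leftEmb_mem h l₁ l₂ l₃ N j)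
  simp only [isExpansion_iff hq g₁ g₂ g₃]
  refine ⟨c, eq_of_lTensor_lastCoord (l₁ := l₁) (l₂ := l₂) hq g₃
    (rep₃_E_leftEmb hq g₁ g₂ g₃ g₁₂ N j) ?_ ?_, fun d hd => hinj d c ?_⟩
  · simp only [map_sum, map_smul, rep₃_E_rightEmb hq g₁ g₂ g₃ g₂₃, smul_zero,
      Finset.sum_const_zero]
  · simp only [map_sum, map_smul]
    exact hc.symm
  · have hd' := congrArg ((lastCoord V 0).lTensor V) hd
    simp only [map_sum, map_smul] at hd'
    exact hd'.symm.trans hc.symm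

theorem leftEmb_eq_sum_sixJ (hq : NotRootOfUnity h) (g₁ : Generic h l₁) (g₂ : Generic h l₂)
    (g₃ : Generic h l₃) (g₁₂ : Generic h (l₁ + l₂)) (g₂₃ : Generic h (l₂ + l₃))
    (g : Generic h (l₁ + l₂ + l₃)) (N : ℕ) (j : Fin (N + 1)) :
    leftEmb h l₁ l₂ l₃ N j (e 0) =
      ∑ n, sixJ h l₁ l₂ l₃ N j n • rightEmb h l₁ l₂ l₃ N n (e 0) :=
  (isExpansion_iff hq g₁ g₂ g₃ N j _).mp
    (Classical.epsilon_spec (existsUnique_isExpansion hq g₁ g₂ g₃ g₁₂ g₂₃ g N j).exists)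

/-- The matrix of `q6j`-symbols. -/
def sixJMatrix (h l₁ l₂ l₃ : ℂ) (N : ℕ) : Matrix (Fin (N + 1)) (Fin (N + 1)) ℂ :=
  Matrix.of (sixJ h l₁ l₂ l₃ N)

/-- Both families of highest weight vectors are orthonormal for the same symmetric pairing on the
triple product. -/
theorem sixJMatrix_mul_transpose (hq : NotRootOfUnity h) (g₁ : Generic h l₁)
    (g₂ : Generic h l₂) (g₃ : Generic h l₃) (g₁₂ : Generic h (l₁ + l₂))
    (g₂₃ : Generic h (l₂ + l₃)) (g : Generic h (l₁ + l₂ + l₃)) (N : ℕ) :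
    sixJMatrix h l₁ l₂ l₃ N * (sixJMatrix h l₁ l₂ l₃ N).transpose = 1 := by
  ext i j
  have h1 := form₃_leftEmb hq g₁ g₂ g₃ g₁₂ g N i j
  rw [leftEmb_eq_sum_sixJ hq g₁ g₂ g₃ g₁₂ g₂₃ g, leftEmb_eq_sum_sixJ hq g₁ g₂ g₃ g₁₂ g₂₃ g,
    form₃_sum_rightEmb hq g₁ g₂ g₃ g₂₃ g] at h1
  rw [Matrix.mul_apply, Matrix.one_apply, ← h1]
  rfl

end Orthogonality

/-! ### The Racah identity -/

section Racah

open Matrix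

/-- The hexagon in components, with the factors `hwvRatio` of the middle step inverted. -/
theorem sixJMatrix_mul_mul {h l₁ l₂ l₃ : ℂ} (hq : NotRootOfUnity h) (g₁ : Generic h l₁)
    (g₂ : Generic h l₂) (g₃ : Generic h l₃) (g₁₂ : Generic h (l₁ + l₂))
    (g₁₃ : Generic h (l₁ + l₃)) (g₂₃ : Generic h (l₂ + l₃)) (g : Generic h (l₁ + l₂ + l₃))
    (N : ℕ) (m n : Fin (N + 1)) :
    (qpow h (-(2 * l₃ * (m : ℕ))) * hwvRatio h l₁ l₃ m) *
      ∑ j : Fin (N + 1), sixJ h l₃ l₁ l₂ N m j *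
        ((hwvRatio h (l₁ + l₂ - (j : ℕ)) l₃ (N - j))⁻¹ * sixJ h l₁ l₂ l₃ N j n) =
      sixJ h l₁ l₃ l₂ N m n *
        (qpow h (-(2 * l₃ * (N - n : ℕ))) * (hwvRatio h l₂ l₃ n)⁻¹) := by
  have g₃₁ : Generic h (l₃ + l₁) := by rwa [add_comm]
  have g₃₂ : Generic h (l₃ + l₂) := by rwa [add_comm]
  have g' : Generic h (l₁ + l₃ + l₂) := by rwa [add_right_comm]
  have g'' : Generic h (l₃ + l₁ + l₂) := by rwa [add_comm l₃]
  have hB : ∀ j, firstCoord (V ⊗[ℂ] V) (rightEmb h l₃ l₁ l₂ N j (e 0)) =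
      (hwvRatio h (l₁ + l₂ - (j : ℕ)) l₃ (N - j))⁻¹ • ∑ n, sixJ h l₁ l₂ l₃ N j n •
        (lastCoord V 0).lTensor V (rightEmb h l₁ l₂ l₃ N n (e 0)) := by
    intro j
    rw [eq_inv_smul_iff₀ (hwvRatio_ne_zero _ _ _ _), ← lTensor_lastCoord_leftEmb_eq_smul,
      leftEmb_eq_sum_sixJ hq g₁ g₂ g₃ g₁₂ g₂₃ g]
    simp only [map_sum, map_smul]
  -- Expanding both sides by q6j-symbols leaves combinations of the same independent components,
  -- those of `rightEmb h l₁ l₂ l₃`.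
  have key := twist_leftEmb h l₁ l₂ l₃ N m
  rw [leftEmb_eq_sum_sixJ hq g₁ g₃ g₂ g₁₃ g₃₂ g', leftEmb_eq_sum_sixJ hq g₃ g₁ g₂ g₃₁ g₁₂ g'']
    at key
  simp only [map_sum, map_smul, twist_rightEmb, hB, Finset.smul_sum, smul_smul] at key
  rw [Finset.sum_comm] at key
  simp only [← Finset.sum_smul] at key
  have h1 := congrFun (sum_lTensor_lastCoord_rightEmb_injective hq g₁ g₂ g₃ g₂₃ g N _ _ key) n
  rw [h1, Finset.mul_sum]

theorem racah_matrix {h l₁ l₂ l₃ : ℂ} (hq : NotRootOfUnity h) (g₁ : Generic h l₁)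
    (g₂ : Generic h l₂) (g₃ : Generic h l₃) (g₁₂ : Generic h (l₁ + l₂))
    (g₁₃ : Generic h (l₁ + l₃)) (g₂₃ : Generic h (l₂ + l₃)) (g : Generic h (l₁ + l₂ + l₃))
    (N : ℕ) (m n : Fin (N + 1)) :
    ∑ j : Fin (N + 1), sixJ h l₃ l₁ l₂ N m j *
        (hwvRatio h (l₁ + l₂ - (j : ℕ)) l₃ (N - j) * sixJ h l₁ l₂ l₃ N j n) =
      qpow h (-(2 * l₃ * (m : ℕ))) * hwvRatio h l₁ l₃ m * (sixJ h l₁ l₃ l₂ N m n *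
        (qpow h (2 * l₃ * (N - n : ℕ)) * hwvRatio h l₂ l₃ n)) := by
  have g₃₁ : Generic h (l₃ + l₁) := by rwa [add_comm]
  have g₃₂ : Generic h (l₃ + l₂) := by rwa [add_comm]
  have g' : Generic h (l₁ + l₃ + l₂) := by rwa [add_right_comm]
  have g'' : Generic h (l₃ + l₁ + l₂) := by rwa [add_comm l₃]
  let A := sixJMatrix h l₁ l₂ l₃ N
  let B := sixJMatrix h l₃ l₁ l₂ N
  let C := sixJMatrix h l₁ l₃ l₂ N
  have hA : Aᵀ * A = 1 :=
    mul_eq_one_comm.mp (sixJMatrix_mul_transpose hq g₁ g₂ g₃ g₁₂ g₂₃ g N)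
  have hB : Bᵀ * B = 1 :=
    mul_eq_one_comm.mp (sixJMatrix_mul_transpose hq g₃ g₁ g₂ g₃₁ g₁₂ g'' N)
  have hC : C * Cᵀ = 1 := sixJMatrix_mul_transpose hq g₁ g₃ g₂ g₁₃ g₃₂ g' N
  let s : Fin (N + 1) → ℂ := fun j => hwvRatio h (l₁ + l₂ - (j : ℕ)) l₃ (N - j)
  let u : Fin (N + 1) → ℂ := fun m => qpow h (-(2 * l₃ * (m : ℕ))) * hwvRatio h l₁ l₃ m
  let w : Fin (N + 1) → ℂ := fun n => qpow h (2 * l₃ * (N - n : ℕ)) * hwvRatio h l₂ l₃ n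
  have hs : diagonal s * diagonal s⁻¹ = 1 := by
    rw [diagonal_mul_diagonal, ← diagonal_one]
    congr 1; funext j
    exact mul_inv_cancel₀ (hwvRatio_ne_zero _ _ _ _)
  have hu : diagonal u * diagonal u⁻¹ = 1 := by
    rw [diagonal_mul_diagonal, ← diagonal_one]
    congr 1; funext j
    exact mul_inv_cancel₀ (mul_ne_zero (qpow_ne_zero _ _) (hwvRatio_ne_zero _ _ _ _))
  have hw : diagonal w⁻¹ * diagonal w = 1 := by
    rw [diagonal_mul_diagonal, ← diagonal_one]
    congr 1; funext j
    exact inv_mul_cancel₀ (mul_ne_zero (qpow_ne_zero _ _) (hwvRatio_ne_zero _ _ _ _))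
  have key : diagonal u * (B * (diagonal s⁻¹ * A)) = C * diagonal w⁻¹ := by
    ext m n
    have := sixJMatrix_mul_mul hq g₁ g₂ g₃ g₁₂ g₁₃ g₂₃ g N m n
    rw [diagonal_mul, mul_diagonal, mul_apply]
    simp only [diagonal_mul]
    refine this.trans ?_
    have hx : qpow h (-(2 * l₃ * (N - n : ℕ))) = (qpow h (2 * l₃ * (N - n : ℕ)))⁻¹ :=
      eq_inv_of_mul_eq_one_right (qpow_mul_neg _ _)
    rw [hx, ← mul_inv]
    rfl
  -- `B s⁻¹ A` has left inverse `(B s A)ᵀ` by orthogonality of `A` and `B`, and right inverse `(u C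
  -- w)ᵀ` by `key` and orthogonality of `C`. The two inverses coincide.
  have h1 : (B * (diagonal s * A))ᵀ * (B * (diagonal s⁻¹ * A)) = 1 := by
    rw [transpose_mul, transpose_mul, diagonal_transpose]
    calc _ = Aᵀ * (diagonal s * (Bᵀ * B) * diagonal s⁻¹) * A := by simp only [mul_assoc]
      _ = 1 := by rw [hB, mul_one, hs, mul_one, hA]
  have h2 : B * (diagonal s⁻¹ * A) * (diagonal u * (C * diagonal w))ᵀ = 1 := by
    rw [transpose_mul, transpose_mul, diagonal_transpose, diagonal_transpose, mul_eq_one_comm]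
    calc _ = diagonal w * Cᵀ * (diagonal u * (B * (diagonal s⁻¹ * A))) := by
          simp only [mul_assoc]
      _ = 1 := by
        rw [key, mul_eq_one_comm]
        calc _ = C * (diagonal w⁻¹ * diagonal w) * Cᵀ := by simp only [mul_assoc]
          _ = 1 := by rw [hw, mul_one, hC]
  have h3 := transpose_injective (left_inv_eq_right_inv h1 h2)
  have h4 := congrFun (congrFun h3 m) n
  rw [diagonal_mul, mul_diagonal, mul_apply] at h4
  simp only [diagonal_mul] at h4
  exact h4

end Racah

/-! ### Signs, powers of `q` and the final form of the identity -/

theorem neg_one_cpow_sub_nat (x : ℂ) (n : ℕ) : (-1 : ℂ) ^ (x - n) = (-1) ^ x * (-1) ^ n := by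
  rw [Complex.cpow_sub _ _ (by norm_num), Complex.cpow_natCast, div_eq_mul_inv, ← inv_pow]
  norm_num

theorem neg_one_cpow_add_nat (x : ℂ) (n : ℕ) : (-1 : ℂ) ^ (x + n) = (-1) ^ x * (-1) ^ n := by
  rw [Complex.cpow_add _ _ (by norm_num), Complex.cpow_natCast]

theorem racah {h l₁ l₂ l₃ : ℂ} (hq : NotRootOfUnity h) (g₁ : Generic h l₁)
    (g₂ : Generic h l₂) (g₃ : Generic h l₃) (g₁₂ : Generic h (l₁ + l₂))
    (g₁₃ : Generic h (l₁ + l₃)) (g₂₃ : Generic h (l₂ + l₃)) (g : Generic h (l₁ + l₂ + l₃))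
    (N : ℕ) (m n : Fin (N + 1)) {l₁₃ l₂₃ l : ℂ} (h₁₃ : l₁₃ = l₁ + l₃ - (m : ℕ))
    (h₂₃ : l₂₃ = l₂ + l₃ - (n : ℕ)) (hl : l = l₁ + l₂ + l₃ - N) :
    ∑ j : Fin (N + 1), (-1 : ℂ) ^ (l₁ + l₂ - (j : ℕ)) *
        qpow h (-((l₁ + l₂ - (j : ℕ)) * (l₁ + l₂ - (j : ℕ) + 1))) *
        sixJ h l₁ l₂ l₃ N j n * sixJ h l₃ l₁ l₂ N m j =
      (-1 : ℂ) ^ (l₁ + l₂ + l₃ + l - l₁₃ - l₂₃) *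
        qpow h (l₁₃ * (l₁₃ + 1) + l₂₃ * (l₂₃ + 1) - l₁ * (l₁ + 1) - l₂ * (l₂ + 1)
          - l₃ * (l₃ + 1) - l * (l + 1)) * sixJ h l₁ l₃ l₂ N m n := by
  have hN : ∀ j : Fin (N + 1), ((N - j : ℕ) : ℂ) = N - (j : ℕ) := fun j =>
    Nat.cast_sub (Nat.lt_succ_iff.mp j.2)
  -- In `hwvRatio h (l₁ + l₂ - j) l₃ (N - j)` the resulting weight is always `l`, so `j` enters only
  -- through the sign and `q ^ (-α (α + 1))`, `α = l₁ + l₂ - j`. The constant `κ` cancels everything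
  -- else.
  set κ : ℂ := (-1) ^ (l₁ + l₂) * (-1) ^ N *
    qpow h ((2 * l₃ - l) * (l + 1) - l₃ * (l₃ + 1))
  have h1 : ∀ j : Fin (N + 1), (-1 : ℂ) ^ (l₁ + l₂ - (j : ℕ)) *
      qpow h (-((l₁ + l₂ - (j : ℕ)) * (l₁ + l₂ - (j : ℕ) + 1))) =
      κ * hwvRatio h (l₁ + l₂ - (j : ℕ)) l₃ (N - j) := by
    intro j
    -- `N + (N - j)` and `j` have the same parity.
    have hs : (-1 : ℂ) ^ N * (-1) ^ (N - j : ℕ) = (-1) ^ (j : ℕ) := by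
      have h0 : ∀ a k : ℕ, (-1 : ℂ) ^ (a + k) * (-1) ^ k = (-1) ^ a := fun a k => by
        rw [pow_add, mul_assoc, ← mul_pow]; simp
      have := h0 j (N - j)
      rwa [Nat.add_sub_cancel' (Nat.lt_succ_iff.mp j.2)] at this
    have hx : qpow h (-((l₁ + l₂ - (j : ℕ)) * (l₁ + l₂ - (j : ℕ) + 1))) =
        qpow h ((2 * l₃ - l) * (l + 1) - l₃ * (l₃ + 1)) *
        qpow h (-((2 * l₃ - (l₁ + l₂ - (j : ℕ) + l₃ - (N - j : ℕ))) *
          (l₁ + l₂ - (j : ℕ) + l₃ - (N - j : ℕ) + 1) +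
          (l₁ + l₂ - (j : ℕ)) * (l₁ + l₂ - (j : ℕ) + 1) - l₃ * (l₃ + 1))) := by
      rw [← qpow_add, hN, hl]; congr 1; ring
    rw [neg_one_cpow_sub_nat, hwvRatio, hx, ← hs]
    ring
  have h2 : (-1 : ℂ) ^ (l₁ + l₂ + l₃ + l - l₁₃ - l₂₃) *
        qpow h (l₁₃ * (l₁₃ + 1) + l₂₃ * (l₂₃ + 1) - l₁ * (l₁ + 1) - l₂ * (l₂ + 1)
          - l₃ * (l₃ + 1) - l * (l + 1)) =
      κ * (qpow h (-(2 * l₃ * (m : ℕ))) * hwvRatio h l₁ l₃ m *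
        (qpow h (2 * l₃ * (N - n : ℕ)) * hwvRatio h l₂ l₃ n)) := by
    have hx : l₁ + l₂ + l₃ + l - l₁₃ - l₂₃ = l₁ + l₂ + (m : ℕ) + (n : ℕ) - N := by
      rw [h₁₃, h₂₃, hl]; ring
    have hy : qpow h (l₁₃ * (l₁₃ + 1) + l₂₃ * (l₂₃ + 1) - l₁ * (l₁ + 1) - l₂ * (l₂ + 1)
          - l₃ * (l₃ + 1) - l * (l + 1)) =
        qpow h ((2 * l₃ - l) * (l + 1) - l₃ * (l₃ + 1)) * qpow h (-(2 * l₃ * (m : ℕ))) *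
        qpow h (-((2 * l₃ - (l₁ + l₃ - (m : ℕ))) * (l₁ + l₃ - (m : ℕ) + 1)
          + l₁ * (l₁ + 1) - l₃ * (l₃ + 1))) * qpow h (2 * l₃ * (N - n : ℕ)) *
        qpow h (-((2 * l₃ - (l₂ + l₃ - (n : ℕ))) * (l₂ + l₃ - (n : ℕ) + 1)
          + l₂ * (l₂ + 1) - l₃ * (l₃ + 1))) := by
      simp only [← qpow_add]
      rw [hN, hl, h₁₃, h₂₃]; congr 1; ring
    rw [hx, neg_one_cpow_sub_nat, neg_one_cpow_add_nat, neg_one_cpow_add_nat, hy, hwvRatio,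
      hwvRatio]
    ring
  rw [h2]
  have h3 := racah_matrix hq g₁ g₂ g₃ g₁₂ g₁₃ g₂₃ g N m n
  calc _ = κ * ∑ j : Fin (N + 1), sixJ h l₃ l₁ l₂ N m j *
        (hwvRatio h (l₁ + l₂ - (j : ℕ)) l₃ (N - j) * sixJ h l₁ l₂ l₃ N j n) := by
        rw [Finset.mul_sum]
        refine Finset.sum_congr rfl fun j _ => ?_
        rw [h1]; ring
    _ = _ := by rw [h3]; ring

end QSixJ

end

theorem mainTheorem3 (h : ℂ) (hq : QSixJ.NotRootOfUnity h)
    (l₁ l₂ l₃ l₁₃ l₂₃ l₁₂₃ : ℂ) (N : ℕ) (n₁₃ n₂₃ : Fin (N + 1))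
    (h₁₂₃ : l₁ + l₂ + l₃ - l₁₂₃ = N)
    (h₁₃ : l₁ + l₃ - l₁₃ = (n₁₃ : ℕ)) (h₂₃ : l₂ + l₃ - l₂₃ = (n₂₃ : ℕ))
    (g₁ : QSixJ.Generic h l₁) (g₂ : QSixJ.Generic h l₂) (g₃ : QSixJ.Generic h l₃)
    (g₁₂ : QSixJ.Generic h (l₁ + l₂)) (g₁₃ : QSixJ.Generic h l₁₃)
    (g₂₃ : QSixJ.Generic h l₂₃) (g₁₂₃ : QSixJ.Generic h l₁₂₃) :
    (∀ n₁₂ : Fin (N + 1), ∃! c : Fin (N + 1) → ℂ, QSixJ.IsExpansion h l₁ l₂ l₃ N n₁₂ c) ∧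
    ∑ j : Fin (N + 1),
      (-1 : ℂ) ^ (l₁ + l₂ - (j : ℕ)) *
        QSixJ.qpow h (-((l₁ + l₂ - (j : ℕ)) * (l₁ + l₂ - (j : ℕ) + 1))) *
        QSixJ.sixJ h l₁ l₂ l₃ N j n₂₃ * QSixJ.sixJ h l₃ l₁ l₂ N n₁₃ j =
      (-1 : ℂ) ^ (l₁ + l₂ + l₃ + l₁₂₃ - l₁₃ - l₂₃) *
        QSixJ.qpow h (l₁₃ * (l₁₃ + 1) + l₂₃ * (l₂₃ + 1) - l₁ * (l₁ + 1) - l₂ * (l₂ + 1)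
          - l₃ * (l₃ + 1) - l₁₂₃ * (l₁₂₃ + 1)) *
        QSixJ.sixJ h l₁ l₃ l₂ N n₁₃ n₂₃ := by
  have k₁₃ : QSixJ.Generic h (l₁ + l₃) := by
    rw [sub_eq_iff_eq_add'.mp h₁₃]; exact_mod_cast g₁₃.add_int (n₁₃ : ℕ)
  have k₂₃ : QSixJ.Generic h (l₂ + l₃) := by
    rw [sub_eq_iff_eq_add'.mp h₂₃]; exact_mod_cast g₂₃.add_int (n₂₃ : ℕ)
  have k : QSixJ.Generic h (l₁ + l₂ + l₃) := by
    rw [sub_eq_iff_eq_add'.mp h₁₂₃]; exact_mod_cast g₁₂₃.add_int N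
  exact ⟨QSixJ.existsUnique_isExpansion hq g₁ g₂ g₃ g₁₂ k₂₃ k N,
    QSixJ.racah hq g₁ g₂ g₃ g₁₂ k₁₃ k₂₃ k N n₁₃ n₂₃ (by rw [← h₁₃]; ring)
      (by rw [← h₂₃]; ring) (by rw [← h₁₂₃]; ring)⟩
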